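/- Let $N\ge 2$ be an integer, $-2<\alpha<0$, $-1<\sigma<0$, $\zeta(t)=t^\sigma$ for $t>0$, and let $p\ge 1+\frac{2+\alpha}{N-2(\sigma+1)}$. Set $$p_c=\frac{N(p-1)}{2+\alpha},\qquad \ell=\frac{N(p-1)}{2+\alpha+2(\sigma+1)(p-1)}.$$ Let $e^{t\Delta}\varphi=G_t\star\varphi$, $G_t(x)=(4\pi t)^{-N/2}e^{-|x|^2/(4t)}$, be the heat semigroup on $\mathbb R^N$. Then there exist $r>p$ with $$\max\Big\{\frac{\alpha p+2}{Np(p-1)},\ \frac1{p_c}+\frac{2\sigma}{N}\Big\}<\frac1r<\min\Big\{\frac1{p_c},\ \frac{N+\alpha}{Np}\Big\}$$ and $\varepsilon>0$, both depending only on $N,\alpha,\sigma,p$, such that for all real-valued $u_0\in L^{p_c}(\mathbb R^N)$ and $\mathbf w\in L^{\ell}(\mathbb R^N)$ with $\|u_0\|_{L^{p_c}}+\|\mathbf w\|_{L^\ell}<\varepsilon$ there is a function $u\in C\big((0,\infty);L^r(\mathbb R^N)\big)$ with $$\sup_{t>0}\,t^{\mu}\|u(t)\|_{L^r}<\infty,\qquad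 \mu=\frac N2\Big(\frac1{p_c}-\frac1r\Big),$$ which solves, for every $t>0$, $$u(t)=e^{t\Delta}u_0+\int_0^t e^{(t-\tau)\Delta}\big(|\cdot|^\alpha|u(\tau)|^p\big)\,d\tau+\int_0^t e^{(t-\tau)\Delta}\big(\zeta(\tau)\,\mathbf w\big)\,d\tau .$$ Here every term is well defined: the convolutions converge absolutely and lie in $L^r(\mathbb R^N)$, and the time integrals converge as Bochner integrals in $L^r(\mathbb R^N)$. -/

import Mathlib

open MeasureTheory Set

open scoped ENNReal

noncomputable section

/-- The Gaussian heat kernel `G_t(x) = (4πt)^{-N/2} exp(-|x|²/(4t))` on `ℝ^N`, for `t > 0`. -/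
def heatKernel (N : ℕ) (t : ℝ) (x : EuclideanSpace ℝ (Fin N)) : ℝ :=
  (4 * Real.pi * t) ^ (-(N : ℝ) / 2) * Real.exp (-‖x‖ ^ 2 / (4 * t))

/-- The heat semigroup `e^{tΔ} φ = G_t ⋆ φ`, for `t > 0`. -/
def heatFlow {N : ℕ} (t : ℝ) (φ : EuclideanSpace ℝ (Fin N) → ℝ) :
    EuclideanSpace ℝ (Fin N) → ℝ :=
  convolution (heatKernel N t) φ (ContinuousLinearMap.lsmul ℝ ℝ) volume

/-- `e^{tΔ} φ` is meaningful (the convolution integral converges absolutely at every point)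
and belongs to `L^q`. -/
def HeatFlowMemLp {N : ℕ} (q : ℝ≥0∞) (t : ℝ) (φ : EuclideanSpace ℝ (Fin N) → ℝ) : Prop :=
  ConvolutionExists (heatKernel N t) φ (ContinuousLinearMap.lsmul ℝ ℝ) volume ∧
    MemLp (heatFlow t φ) q volume

open Classical in
/-- `e^{tΔ} φ` as an element of `L^q`. The value `0` outside the case `e^{tΔ} φ ∈ L^q` is a
convention, which is never used where `HeatFlowMemLp q t φ` holds. -/
def heatFlowLp {N : ℕ} (q : ℝ≥0∞) (t : ℝ) (φ : EuclideanSpace ℝ (Fin N) → ℝ) :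
    Lp ℝ q (volume : Measure (EuclideanSpace ℝ (Fin N))) :=
  if h : MemLp (heatFlow t φ) q volume then h.toLp (heatFlow t φ) else 0

/-- `u` is a global-in-time mild solution, continuous on `(0,∞)` with values in `L^q(ℝ^N)`, of
`u_t - Δu = |x|^α |u|^p + ζ(t) w(x)`, `u(0) = u₀`. That is, for every `t > 0`,
`u(t) = e^{tΔ} u₀ + ∫₀ᵗ e^{(t-τ)Δ}(|·|^α |u(τ)|^p) dτ + ∫₀ᵗ e^{(t-τ)Δ}(ζ(τ) w) dτ`,
where every term is a well-defined element of `L^q` and the time integrals are convergent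
Bochner integrals in `L^q`. The values `u t` with `t ≤ 0` play no role. -/
structure IsGlobalMildSolution {N : ℕ} (α p : ℝ) (ζ : ℝ → ℝ)
    (u₀ w : EuclideanSpace ℝ (Fin N) → ℝ) (q : ℝ≥0∞) [Fact (1 ≤ q)]
    (u : ℝ → Lp ℝ q (volume : Measure (EuclideanSpace ℝ (Fin N)))) : Prop where
  continuousOn : ContinuousOn u (Ioi 0)
  initial_mem : ∀ t : ℝ, 0 < t → HeatFlowMemLp q t u₀
  source_mem : ∀ t τ : ℝ, 0 < τ → τ < t →
    HeatFlowMemLp q (t - τ) (fun x => ‖x‖ ^ α * |u τ x| ^ p)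
  forcing_mem : ∀ t τ : ℝ, 0 < τ → τ < t → HeatFlowMemLp q (t - τ) (fun x => ζ τ * w x)
  source_integrable : ∀ t : ℝ, 0 < t →
    IntervalIntegrable (fun τ => heatFlowLp q (t - τ) (fun x => ‖x‖ ^ α * |u τ x| ^ p))
      volume 0 t
  forcing_integrable : ∀ t : ℝ, 0 < t →
    IntervalIntegrable (fun τ => heatFlowLp q (t - τ) (fun x => ζ τ * w x)) volume 0 t
  integral_eq : ∀ t : ℝ, 0 < t →
    u t = heatFlowLp q t u₀
      + (∫ τ in (0 : ℝ)..t, heatFlowLp q (t - τ) (fun x => ‖x‖ ^ α * |u τ x| ^ p))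
      + ∫ τ in (0 : ℝ)..t, heatFlowLp q (t - τ) (fun x => ζ τ * w x)

end

/-! The integral equation is solved by contraction in the scale-invariant space of curves with
`‖u(t)‖_r = O(t^{-μ})`. Write `K_s(v) = e^{sΔ}(|·|^α |v|^p)`. Two facts combine. The map `v ↦ |v|^p`
is locally Lipschitz from `L^r` to `L^{r/p}`. The weighted semigroup `e^{sΔ}(|·|^α ·)` maps
`L^{r/p}` to `L^r` with norm at most `C s^{-β}`, where `β = (N/2)(p/r - 1/r) - α/2`; this follows
from Young's inequality after cutting the weight at `|x| = √s`. On the space above, the Duhamel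
integrand is thus at most a constant times `(t-τ)^{-β} τ^{-μp}`, and its integral is a beta integral
times `t^{1-β-μp}`. By the definition of `p_c` the last exponent is `-μ`, so the space is preserved,
and the Lipschitz constant is small on a small ball.

The data enter in the same way: `e^{tΔ}u₀` decays like `t^{-μ}` by the `L^{p_c}`-`L^r` estimate. The
forcing is bounded by `(t-τ)^{-κ} τ^σ`, and `ℓ` is the exponent for which this too integrates to
`t^{-μ}`.

The conditions on `r` express convergence: `1/r < 1/p_c` is `β < 1`, the bound by `(N+α)/(Np)` makes
the weight integrable at the origin in the dual exponent, and the two lower bounds are `μp < 1` and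
`κ < 1`. The hypothesis on `p` is `ℓ ≥ 1`, and it also leaves room for such an `r`. -/

/-! ### Young's convolution inequality on abelian groups. -/

section Young

variable {G : Type*} [AddCommGroup G] [MeasurableSpace G] [MeasurableAdd₂ G] [MeasurableNeg G]
  {μ : Measure G} [μ.IsAddLeftInvariant]

section

variable [μ.IsNegInvariant]

theorem MeasureTheory.MemLp.convolutionExists_lsmul {f g : G → ℝ} {p q : ℝ≥0∞} [hpq : ENNReal.HolderTriple p q 1]
    (hf : MemLp f p μ) (hg : MemLp g q μ) :
    ConvolutionExists f g (ContinuousLinearMap.lsmul ℝ ℝ) μ := by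
  intro x
  have hgx : MemLp (fun y => g (x - y)) q μ :=
    hg.comp_measurePreserving (Measure.measurePreserving_sub_left μ x)
  have := hgx.mul hf (r := 1)
  rw [memLp_one_iff_integrable] at this
  exact this

end

variable [SFinite μ]

theorem lintegral_lintegral_mul_sub_eq {f g : G → ℝ≥0∞} (hf : AEMeasurable f μ)
    (hg : AEMeasurable g μ) :
    ∫⁻ x, ∫⁻ y, f y * g (x - y) ∂μ ∂μ = (∫⁻ y, f y ∂μ) * ∫⁻ y, g y ∂μ := by
  have hm : AEMeasurable (Function.uncurry fun x y => f y * g (x - y)) (μ.prod μ) := by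
    refine AEMeasurable.mul ?_ ?_
    · exact hf.comp_quasiMeasurePreserving Measure.quasiMeasurePreserving_snd
    · exact hg.comp_quasiMeasurePreserving
        (quasiMeasurePreserving_sub_of_right_invariant μ μ)
  rw [lintegral_lintegral_swap hm, ← lintegral_mul_const'' _ hf]
  congr 1
  ext y
  have hgy : AEMeasurable (fun x => g (x - y)) μ := hg.comp_quasiMeasurePreserving
    (measurePreserving_sub_right μ y).quasiMeasurePreserving
  rw [lintegral_const_mul'' _ hgy]
  rw [lintegral_sub_right_eq_self (μ := μ) g y]

theorem MeasureTheory.AEStronglyMeasurable.convolution_lsmul {f g : G → ℝ} (hf : AEStronglyMeasurable f μ)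
    (hg : AEStronglyMeasurable g μ) :
    AEStronglyMeasurable (convolution f g (ContinuousLinearMap.lsmul ℝ ℝ) μ) μ :=
  (hf.convolution_integrand (ContinuousLinearMap.lsmul ℝ ℝ) hg).integral_prod_right'

variable [μ.IsNegInvariant]

/-- Three-factor Hölder applied to `f g = (f^p g^q)^{1/r} · f^{1-p/r} · g^{1-q/r}`; the weights
`1/r`, `1/p - 1/r`, `1/q - 1/r` sum to `1` by the relation between the exponents. Raised to the
power `r` and integrated in `x`, only the first factor depends on `x`, and Tonelli evaluates it. -/
theorem lintegral_mul_sub_le_of_young {f g : G → ℝ≥0∞} (hf : AEMeasurable f μ)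
    (hg : AEMeasurable g μ) {p q r : ℝ} (hp : 1 ≤ p) (hq : 1 ≤ q) (hr : 1 ≤ r)
    (hpqr : 1 / p + 1 / q = 1 + 1 / r) (x : G) :
    ∫⁻ y, f y * g (x - y) ∂μ ≤
      (∫⁻ y, f y ^ p * g (x - y) ^ q ∂μ) ^ (1 / r) * (∫⁻ y, f y ^ p ∂μ) ^ (1 / p - 1 / r) *
        (∫⁻ y, g y ^ q ∂μ) ^ (1 / q - 1 / r) := by
  have hp1 : 1 / p ≤ 1 := by rw [div_le_one (by linarith)]; exact hp
  have hq1 : 1 / q ≤ 1 := by rw [div_le_one (by linarith)]; exact hq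
  have hr0 : 0 ≤ 1 / r := by positivity
  have hgx : AEMeasurable (fun y => g (x - y)) μ :=
    hg.comp_quasiMeasurePreserving (quasiMeasurePreserving_sub_left_of_right_invariant μ x)
  have key := ENNReal.lintegral_prod_norm_pow_le (μ := μ) (Finset.univ : Finset (Fin 3))
    (f := ![fun y => f y ^ p * g (x - y) ^ q, fun y => f y ^ p, fun y => g (x - y) ^ q])
    (p := ![1 / r, 1 / p - 1 / r, 1 / q - 1 / r]) (by
      intro i _
      fin_cases i
      · exact (hf.pow_const _).mul (hgx.pow_const _)
      · exact hf.pow_const _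
      · exact hgx.pow_const _) (by
      simp [Fin.sum_univ_three] at hpqr ⊢; linarith) (by
      intro i _
      fin_cases i
      · exact hr0
      · simp at *; linarith
      · simp at *; linarith)
  simp only [Fin.prod_univ_three, Matrix.cons_val_zero, Matrix.cons_val_one, Matrix.cons_val] at key
  have h2 : ∫⁻ y, g (x - y) ^ q ∂μ = ∫⁻ y, g y ^ q ∂μ :=
    lintegral_sub_left_eq_self (fun y => g y ^ q) x
  rw [h2] at key
  refine le_trans (le_of_eq ?_) key
  congr 1
  ext y
  rw [ENNReal.mul_rpow_of_nonneg _ _ hr0, ← ENNReal.rpow_mul, ← ENNReal.rpow_mul,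
    ← ENNReal.rpow_mul, ← ENNReal.rpow_mul]
  have e1 : f y = f y ^ (p * (1 / r)) * f y ^ (p * (1 / p - 1 / r)) := by
    rw [← ENNReal.rpow_add_of_nonneg _ _ (by positivity)
      (mul_nonneg (by linarith) (by linarith)), ← mul_add]
    have : p * (1 / r + (1 / p - 1 / r)) = 1 := by field_simp; ring
    rw [this, ENNReal.rpow_one]
  have e2 : g (x - y) = g (x - y) ^ (q * (1 / r)) * g (x - y) ^ (q * (1 / q - 1 / r)) := by
    rw [← ENNReal.rpow_add_of_nonneg _ _ (by positivity)
      (mul_nonneg (by linarith) (by linarith)), ← mul_add]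
    have : q * (1 / r + (1 / q - 1 / r)) = 1 := by field_simp; ring
    rw [this, ENNReal.rpow_one]
  conv_lhs => rw [e1, e2]
  ring

/-- **Young's convolution inequality** for finite exponents. -/
theorem eLpNorm_convolution_le {f g : G → ℝ} (hf : AEStronglyMeasurable f μ)
    (hg : AEStronglyMeasurable g μ) {p q r : ℝ} (hp : 1 ≤ p) (hq : 1 ≤ q) (hr : 1 ≤ r)
    (hpqr : 1 / p + 1 / q = 1 + 1 / r) :
    eLpNorm (convolution f g (ContinuousLinearMap.lsmul ℝ ℝ) μ) (ENNReal.ofReal r) μ ≤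
      eLpNorm f (ENNReal.ofReal p) μ * eLpNorm g (ENNReal.ofReal q) μ := by
  have hp1 : 1 / p ≤ 1 := by rw [div_le_one (by linarith)]; exact hp
  have hq1 : 1 / q ≤ 1 := by rw [div_le_one (by linarith)]; exact hq
  have hr0 : 0 ≤ 1 / r := by positivity
  have hrpos : 0 < r := by linarith
  rw [eLpNorm_eq_lintegral_rpow_enorm_toReal (by simpa using hrpos) (by simp),
    eLpNorm_eq_lintegral_rpow_enorm_toReal (by simp; linarith) (by simp),
    eLpNorm_eq_lintegral_rpow_enorm_toReal (by simp; linarith) (by simp)]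
  rw [ENNReal.toReal_ofReal (by linarith), ENNReal.toReal_ofReal (by linarith),
    ENNReal.toReal_ofReal (by linarith)]
  set A := ∫⁻ y, ‖f y‖ₑ ^ p ∂μ with hA
  set B := ∫⁻ y, ‖g y‖ₑ ^ q ∂μ with hB
  have hfe : AEMeasurable (fun y => ‖f y‖ₑ) μ := hf.enorm
  have hge : AEMeasurable (fun y => ‖g y‖ₑ) μ := hg.enorm
  have hpt : ∀ x, ‖convolution f g (ContinuousLinearMap.lsmul ℝ ℝ) μ x‖ₑ ^ r ≤
      (A ^ (1 / p - 1 / r) * B ^ (1 / q - 1 / r)) ^ r *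
        ∫⁻ y, ‖f y‖ₑ ^ p * ‖g (x - y)‖ₑ ^ q ∂μ := by
    intro x
    have h1 : ‖convolution f g (ContinuousLinearMap.lsmul ℝ ℝ) μ x‖ₑ ≤
        ∫⁻ y, ‖f y‖ₑ * ‖g (x - y)‖ₑ ∂μ := by
      rw [convolution_lsmul]
      refine (enorm_integral_le_lintegral_enorm _).trans (le_of_eq ?_)
      simp only [enorm_smul]
    have h2 := h1.trans (lintegral_mul_sub_le_of_young hfe hge hp hq hr hpqr x)
    refine (ENNReal.rpow_le_rpow h2 hrpos.le).trans (le_of_eq ?_)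
    rw [mul_assoc, ENNReal.mul_rpow_of_nonneg _ _ hrpos.le, ← ENNReal.rpow_mul,
      one_div_mul_cancel hrpos.ne', ENNReal.rpow_one, mul_comm]
  calc (∫⁻ x, ‖convolution f g (ContinuousLinearMap.lsmul ℝ ℝ) μ x‖ₑ ^ r ∂μ) ^ (1 / r)
      ≤ (∫⁻ x, (A ^ (1 / p - 1 / r) * B ^ (1 / q - 1 / r)) ^ r *
        ∫⁻ y, ‖f y‖ₑ ^ p * ‖g (x - y)‖ₑ ^ q ∂μ ∂μ) ^ (1 / r) :=
        ENNReal.rpow_le_rpow (lintegral_mono hpt) hr0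
    _ = ((A ^ (1 / p - 1 / r) * B ^ (1 / q - 1 / r)) ^ r * (A * B)) ^ (1 / r) := by
        have hm : AEMeasurable (Function.uncurry fun x y => ‖f y‖ₑ ^ p * ‖g (x - y)‖ₑ ^ q)
            (μ.prod μ) := by
          refine AEMeasurable.mul ?_ ?_
          · exact (hfe.pow_const p).comp_quasiMeasurePreserving Measure.quasiMeasurePreserving_snd
          · exact (hge.pow_const q).comp_quasiMeasurePreserving
              (quasiMeasurePreserving_sub_of_right_invariant μ μ)
        have hm' : AEMeasurable (fun x => ∫⁻ y, ‖f y‖ₑ ^ p * ‖g (x - y)‖ₑ ^ q ∂μ) μ :=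
          hm.lintegral_prod_right'
        rw [lintegral_const_mul'' _ hm',
          lintegral_lintegral_mul_sub_eq (f := fun y => ‖f y‖ₑ ^ p) (g := fun y => ‖g y‖ₑ ^ q)
            (hfe.pow_const p) (hge.pow_const q)]
    _ = A ^ (1 / p) * B ^ (1 / q) := by
        rw [ENNReal.mul_rpow_of_nonneg _ _ hr0, ← ENNReal.rpow_mul, mul_one_div_cancel hrpos.ne',
          ENNReal.rpow_one, ENNReal.mul_rpow_of_nonneg _ _ hr0, mul_mul_mul_comm,
          ← ENNReal.rpow_add_of_nonneg _ _ (by linarith) hr0,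
          ← ENNReal.rpow_add_of_nonneg _ _ (by linarith) hr0]
        simp

theorem MeasureTheory.MemLp.convolution_lsmul {f g : G → ℝ} {p q r : ℝ} (hf : MemLp f (ENNReal.ofReal p) μ)
    (hg : MemLp g (ENNReal.ofReal q) μ) (hp : 1 ≤ p) (hq : 1 ≤ q) (hr : 1 ≤ r)
    (hpqr : 1 / p + 1 / q = 1 + 1 / r) :
    MemLp (convolution f g (ContinuousLinearMap.lsmul ℝ ℝ) μ) (ENNReal.ofReal r) μ :=
  ⟨hf.1.convolution_lsmul hg.1,
    (eLpNorm_convolution_le hf.1 hg.1 hp hq hr hpqr).trans_lt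
      (ENNReal.mul_lt_top hf.2 hg.2)⟩

end Young

/-! ### Scaling of `L^q` norms under dilations. -/

section Dilation

variable {E F : Type*} [NormedAddCommGroup E] [NormedSpace ℝ E] [FiniteDimensional ℝ E]
  [MeasurableSpace E] [BorelSpace E] [NormedAddCommGroup F]

theorem eLpNorm_comp_smul (μ : Measure E) [μ.IsAddHaarMeasure] (f : E → F) {c q : ℝ} (hc : 0 < c)
    (hq : 0 < q) :
    eLpNorm (fun x => f (c • x)) (ENNReal.ofReal q) μ =
      ENNReal.ofReal (c ^ (-(Module.finrank ℝ E : ℝ) / q)) * eLpNorm f (ENNReal.ofReal q) μ := by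
  have hme : MeasurableEmbedding (fun x : E => c • x) :=
    (Homeomorph.smulOfNeZero c hc.ne').measurableEmbedding
  have h := hme.eLpNorm_map_measure (g := f) (p := ENNReal.ofReal q) (μ := μ)
  rw [Measure.map_addHaar_smul μ hc.ne', eLpNorm_smul_measure_of_ne_top (by simp)] at h
  rw [Function.comp_def] at h
  rw [← h, smul_eq_mul]
  congr 1
  rw [abs_of_pos (by positivity), ENNReal.toReal_div, ENNReal.toReal_ofReal hq.le,
    ENNReal.ofReal_rpow_of_nonneg (by positivity) (by positivity)]
  congr 1
  rw [← Real.rpow_natCast, ← Real.rpow_neg hc.le, ← Real.rpow_mul hc.le]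
  congr 1
  simp; ring

end Dilation

/-! ### The heat kernel: integrability, self-similarity, continuity in time. -/

section HeatKernel

open Filter Topology

theorem continuous_heatKernel (N : ℕ) (t : ℝ) : Continuous (heatKernel N t) := by
  unfold heatKernel; fun_prop

theorem heatKernel_nonneg (N : ℕ) {t : ℝ} (ht : 0 < t) (x : EuclideanSpace ℝ (Fin N)) :
    0 ≤ heatKernel N t x := by
  unfold heatKernel; positivity

theorem integrable_exp_neg_mul_sq_norm (N : ℕ) {b : ℝ} (hb : 0 < b) :
    Integrable (fun x : EuclideanSpace ℝ (Fin N) => Real.exp (-b * ‖x‖ ^ 2)) := by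
  -- A non-integrable function has integral `0` by convention, whereas the closed formula for the
  -- Gaussian integral is positive.
  by_contra h
  have h1 := integral_undef h
  rw [GaussianFourier.integral_rexp_neg_mul_sq_norm hb] at h1
  have : 0 < (Real.pi / b) ^ (Module.finrank ℝ (EuclideanSpace ℝ (Fin N)) / 2 : ℝ) := by
    positivity
  exact this.ne' h1

theorem memLp_exp_neg_mul_sq_norm (N : ℕ) {b : ℝ} (hb : 0 < b) {q : ℝ} (hq : 0 < q) :
    MemLp (fun x : EuclideanSpace ℝ (Fin N) => Real.exp (-b * ‖x‖ ^ 2)) (ENNReal.ofReal q)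
      volume := by
  rw [← integrable_norm_rpow_iff (by fun_prop) (by simpa using hq) (by simp),
    ENNReal.toReal_ofReal hq.le]
  refine (integrable_exp_neg_mul_sq_norm N (mul_pos hb hq)).congr (ae_of_all _ fun x => ?_)
  simp only [Real.norm_eq_abs, Real.abs_exp, ← Real.exp_mul]
  ring_nf

/-- A Gaussian majorant uniform for times near `t`, used for dominated convergence. -/
theorem heatKernel_le (N : ℕ) {s t : ℝ} (ht : 0 < t) (hs : s ∈ Icc (t / 2) (2 * t))
    (x : EuclideanSpace ℝ (Fin N)) :
    heatKernel N s x ≤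
      (2 * Real.pi * t) ^ (-(N : ℝ) / 2) * Real.exp (-(1 / (8 * t)) * ‖x‖ ^ 2) := by
  have hs0 : 0 < s := by linarith [hs.1]
  unfold heatKernel
  refine mul_le_mul ?_ ?_ (Real.exp_pos _).le (by positivity)
  · refine Real.rpow_le_rpow_of_nonpos (by positivity) ?_ ?_
    · nlinarith [Real.pi_pos, hs.1]
    · have : (0 : ℝ) ≤ N := by positivity
      linarith
  · rw [Real.exp_le_exp, neg_mul, neg_div, neg_le_neg_iff, one_div_mul_eq_div]
    exact div_le_div_of_nonneg_left (by positivity) (by positivity) (by linarith [hs.2])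

/-- The exponent `∞` is needed as well: it is conjugate to `1`, so it gives pointwise convergence of
the convolution with `L^1` data. -/
theorem memLp_heatKernel (N : ℕ) {t : ℝ} (ht : 0 < t) {q : ℝ≥0∞} (hq : q ≠ 0) :
    MemLp (heatKernel N t) q volume := by
  by_cases hq' : q = ∞
  · subst hq'
    refine memLp_top_of_bound (continuous_heatKernel N t).aestronglyMeasurable
      ((4 * Real.pi * t) ^ (-(N : ℝ) / 2)) (ae_of_all _ fun x => ?_)
    rw [Real.norm_of_nonneg (heatKernel_nonneg N ht x)]
    unfold heatKernel
    refine mul_le_of_le_one_right (by positivity) ?_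
    rw [Real.exp_le_one_iff]
    exact div_nonpos_of_nonpos_of_nonneg (by simp) (by positivity)
  · have hq0 : 0 < q.toReal := ENNReal.toReal_pos hq hq'
    rw [← ENNReal.ofReal_toReal hq']
    have := (memLp_exp_neg_mul_sq_norm N (b := 1 / (4 * t)) (by positivity) hq0).const_mul
      ((4 * Real.pi * t) ^ (-(N : ℝ) / 2))
    refine this.congr_norm (continuous_heatKernel N t).aestronglyMeasurable
      (ae_of_all _ fun x => ?_)
    unfold heatKernel
    congr 3
    ring

/-- Parabolic self-similarity; all powers of `t` in the smoothing estimates come from it. -/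
theorem heatKernel_eq_dilation (N : ℕ) {t : ℝ} (ht : 0 < t) (x : EuclideanSpace ℝ (Fin N)) :
    heatKernel N t x = t ^ (-(N : ℝ) / 2) * heatKernel N 1 (t ^ (-(1 : ℝ) / 2) • x) := by
  unfold heatKernel
  rw [← mul_assoc, Real.mul_rpow (by positivity) ht.le, mul_one,
    mul_comm (t ^ (-(N : ℝ) / 2)) _]
  congr 2
  have h2 : (t ^ (-(1 : ℝ) / 2)) ^ 2 = t⁻¹ := by
    rw [← Real.rpow_natCast, ← Real.rpow_mul ht.le, ← Real.rpow_neg_one]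
    norm_num
  rw [norm_smul, mul_pow, Real.norm_of_nonneg (by positivity), h2]
  field_simp

theorem eLpNorm_heatKernel (N : ℕ) {t : ℝ} (ht : 0 < t) {q : ℝ} (hq : 0 < q) :
    eLpNorm (heatKernel N t) (ENNReal.ofReal q) volume =
      ENNReal.ofReal (t ^ (-(N : ℝ) / 2 * (1 - 1 / q))) *
        eLpNorm (heatKernel N 1) (ENNReal.ofReal q) volume := by
  have h : heatKernel N t = t ^ (-(N : ℝ) / 2) •
      fun x => heatKernel N 1 (t ^ (-(1 : ℝ) / 2) • x) :=
    funext fun x => heatKernel_eq_dilation N ht x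
  rw [h, eLpNorm_const_smul, eLpNorm_comp_smul volume _ (by positivity) hq, ← mul_assoc,
    Real.enorm_of_nonneg (by positivity), ← ENNReal.ofReal_mul (by positivity),
    ← Real.rpow_mul ht.le, ← Real.rpow_add ht]
  congr 3
  rw [finrank_euclideanSpace_fin]
  field_simp
  ring

theorem tendsto_eLpNorm_heatKernel_sub (N : ℕ) {t : ℝ} (ht : 0 < t) {q : ℝ} (hq : 0 < q) :
    Tendsto (fun s => eLpNorm (heatKernel N s - heatKernel N t) (ENNReal.ofReal q) volume)
      (𝓝 t) (𝓝 0) := by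
  have hq0 : ENNReal.ofReal q ≠ 0 := by simpa using hq
  simp_rw [eLpNorm_eq_lintegral_rpow_enorm_toReal hq0 ENNReal.ofReal_ne_top,
    ENNReal.toReal_ofReal hq.le]
  have hmem : Icc (t / 2) (2 * t) ∈ 𝓝 t := Icc_mem_nhds (by linarith) (by linarith)
  set g : EuclideanSpace ℝ (Fin N) → ℝ := fun x =>
    2 * ((2 * Real.pi * t) ^ (-(N : ℝ) / 2) * Real.exp (-(1 / (8 * t)) * ‖x‖ ^ 2)) with hg
  have hgL : MemLp g (ENNReal.ofReal q) volume :=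
    ((memLp_exp_neg_mul_sq_norm N (by positivity) hq).const_mul _).const_mul _
  have hlim : Tendsto (fun s => ∫⁻ x, ‖(heatKernel N s - heatKernel N t) x‖ₑ ^ q) (𝓝 t)
      (𝓝 (∫⁻ _ : EuclideanSpace ℝ (Fin N), 0)) := by
    refine tendsto_lintegral_filter_of_dominated_convergence (fun x => ‖g x‖ₑ ^ q) ?_ ?_ ?_ ?_
    · refine Eventually.of_forall fun s => ?_
      have := ((continuous_heatKernel N s).sub (continuous_heatKernel N t)).measurable
      exact this.enorm.pow_const q
    · filter_upwards [hmem] with s hs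
      refine ae_of_all _ fun x => ENNReal.rpow_le_rpow ?_ hq.le
      rw [enorm_le_iff_norm_le, Pi.sub_apply, Real.norm_eq_abs, Real.norm_of_nonneg (by
        rw [hg]; positivity), abs_le]
      have h1 := heatKernel_le N ht hs x
      have h2 := heatKernel_le N ht (mem_of_mem_nhds hmem) x
      have h3 := heatKernel_nonneg N (t := s) (by linarith [hs.1]) x
      have h4 := heatKernel_nonneg N ht x
      simp only [hg]
      constructor <;> linarith
    · have := lintegral_rpow_enorm_lt_top_of_eLpNorm_lt_top hq0 ENNReal.ofReal_ne_top hgL.2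
      rw [ENNReal.toReal_ofReal hq.le] at this
      exact this.ne
    · refine ae_of_all _ fun x => ?_
      have hc : ContinuousAt (fun s => (heatKernel N s - heatKernel N t) x) t := by
        unfold heatKernel
        have h4 : 4 * Real.pi * t ≠ 0 := by positivity
        have h5 : 4 * t ≠ 0 := by positivity
        simp only [Pi.sub_apply]
        fun_prop (disch := first | assumption | exact Or.inl h4)
      have := ((ENNReal.continuous_rpow_const (y := q)).tendsto _).comp hc.enorm.tendsto
      simpa [Function.comp_def, hq] using this
  rw [lintegral_zero] at hlim
  have := ((ENNReal.continuous_rpow_const (y := 1 / q)).tendsto 0).comp hlim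
  simpa [Function.comp_def, ENNReal.zero_rpow_of_pos (inv_pos.2 hq)] using this

end HeatKernel

/-! ### The heat semigroup from `L^q` to `L^r`. -/

section HeatFlow

variable {N : ℕ}

theorem HeatFlowMemLp.add {q : ℝ≥0∞} {t : ℝ} {φ ψ : EuclideanSpace ℝ (Fin N) → ℝ}
    (hφ : HeatFlowMemLp q t φ) (hψ : HeatFlowMemLp q t ψ) : HeatFlowMemLp q t (φ + ψ) := by
  have h : heatFlow t (φ + ψ) = heatFlow t φ + heatFlow t ψ := hφ.1.distrib_add hψ.1
  refine ⟨fun x => ?_, h ▸ hφ.2.add hψ.2⟩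
  have := (hφ.1 x).add (hψ.1 x)
  simpa [ConvolutionExistsAt, mul_add, Pi.add_def] using this

theorem HeatFlowMemLp.const_smul {q : ℝ≥0∞} {t : ℝ} {φ : EuclideanSpace ℝ (Fin N) → ℝ}
    (hφ : HeatFlowMemLp q t φ) (c : ℝ) : HeatFlowMemLp q t (c • φ) := by
  have h : heatFlow t (c • φ) = c • heatFlow t φ := convolution_smul
  refine ⟨fun x => ?_, h ▸ hφ.2.const_smul c⟩
  have := (hφ.1 x).const_mul c
  simpa [ConvolutionExistsAt, mul_left_comm] using this

theorem heatFlowLp_of_mem {q : ℝ≥0∞} {t : ℝ} {φ : EuclideanSpace ℝ (Fin N) → ℝ}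
    (hφ : HeatFlowMemLp q t φ) : heatFlowLp q t φ = hφ.2.toLp (heatFlow t φ) :=
  dif_pos hφ.2

theorem heatFlowLp_add {q : ℝ≥0∞} {t : ℝ} {φ ψ : EuclideanSpace ℝ (Fin N) → ℝ}
    (hφ : HeatFlowMemLp q t φ) (hψ : HeatFlowMemLp q t ψ) :
    heatFlowLp q t (φ + ψ) = heatFlowLp q t φ + heatFlowLp q t ψ := by
  have h : heatFlow t (φ + ψ) = heatFlow t φ + heatFlow t ψ := hφ.1.distrib_add hψ.1
  rw [heatFlowLp_of_mem hφ, heatFlowLp_of_mem hψ, heatFlowLp_of_mem (hφ.add hψ),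
    ← MemLp.toLp_add]
  exact MemLp.toLp_congr _ _ (by rw [h])

theorem heatFlowLp_const_smul {q : ℝ≥0∞} {t : ℝ} {φ : EuclideanSpace ℝ (Fin N) → ℝ}
    (hφ : HeatFlowMemLp q t φ) (c : ℝ) : heatFlowLp q t (c • φ) = c • heatFlowLp q t φ := by
  have h : heatFlow t (c • φ) = c • heatFlow t φ := convolution_smul
  rw [heatFlowLp_of_mem hφ, heatFlowLp_of_mem (hφ.const_smul c), ← MemLp.toLp_const_smul]
  exact MemLp.toLp_congr _ _ (by rw [h])

theorem heatFlowLp_sub {q : ℝ≥0∞} {t : ℝ} {φ ψ : EuclideanSpace ℝ (Fin N) → ℝ}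
    (hφ : HeatFlowMemLp q t φ) (hψ : HeatFlowMemLp q t ψ) :
    heatFlowLp q t (φ - ψ) = heatFlowLp q t φ - heatFlowLp q t ψ := by
  have := heatFlowLp_add hφ (hψ.const_smul (-1))
  rw [heatFlowLp_const_smul hψ] at this
  simpa [sub_eq_add_neg] using this

/-- The exponent `k` for which Young's inequality maps `L^k × L^q` to `L^r`. -/
theorem exists_young_exponent {q r : ℝ} (hq : 1 ≤ q) (hqr : q ≤ r) :
    ∃ k : ℝ, 1 ≤ k ∧ 1 / k = 1 + 1 / r - 1 / q := by
  have hq1 : 1 / q ≤ 1 := by rw [div_le_one (by linarith)]; exact hq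
  have h2 : 1 / r ≤ 1 / q := one_div_le_one_div_of_le (by linarith) hqr
  have h3 : 0 < 1 / r := by have : 0 < r := by linarith
                            positivity
  refine ⟨1 / (1 + 1 / r - 1 / q), ?_, by rw [one_div_one_div]⟩
  rw [le_div_iff₀ (by linarith)]
  linarith

/-- The kernel lies in every `L^k`: the conjugate exponent of `q` gives absolute convergence at
every point by Hölder, and the Young exponent gives membership in `L^r`. -/
theorem heatFlowMemLp_of_memLp {q r t : ℝ} (hq : 1 ≤ q) (hqr : q ≤ r) (ht : 0 < t)
    {φ : EuclideanSpace ℝ (Fin N) → ℝ} (hφ : MemLp φ (ENNReal.ofReal q) volume) :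
    HeatFlowMemLp (ENNReal.ofReal r) t φ := by
  obtain ⟨k, hk, hk'⟩ := exists_young_exponent hq hqr
  constructor
  · have : ENNReal.HolderConjugate (ENNReal.conjExponent (ENNReal.ofReal q))
      (ENNReal.ofReal q) :=
      (ENNReal.HolderConjugate.conjExponent (by simpa using hq)).symm
    exact (memLp_heatKernel N ht (ENNReal.HolderConjugate.ne_zero
      (ENNReal.conjExponent (ENNReal.ofReal q)) (ENNReal.ofReal q))).convolutionExists_lsmul hφ
  · exact (memLp_heatKernel N ht (q := ENNReal.ofReal k) (by simp; linarith)).convolution_lsmul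
      hφ hk hq (by linarith) (by rw [hk']; ring)

theorem exists_norm_heatFlowLp_le (N : ℕ) {q r : ℝ} (hq : 1 ≤ q) (hqr : q ≤ r)
    [Fact (1 ≤ ENNReal.ofReal r)] :
    ∃ C : ℝ, 0 ≤ C ∧ ∀ t : ℝ, 0 < t → ∀ φ : EuclideanSpace ℝ (Fin N) → ℝ,
      MemLp φ (ENNReal.ofReal q) volume →
        ‖heatFlowLp (ENNReal.ofReal r) t φ‖ ≤ C * t ^ (-((N : ℝ) / 2 * (1 / q - 1 / r))) *
          (eLpNorm φ (ENNReal.ofReal q) volume).toReal := by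
  obtain ⟨k, hk, hk'⟩ := exists_young_exponent hq hqr
  refine ⟨(eLpNorm (heatKernel N 1) (ENNReal.ofReal k) volume).toReal, ENNReal.toReal_nonneg,
    fun t ht φ hφ => ?_⟩
  have hmem := heatFlowMemLp_of_memLp hq hqr ht hφ
  rw [heatFlowLp_of_mem hmem, Lp.norm_toLp]
  have h1 := eLpNorm_convolution_le (continuous_heatKernel N t).aestronglyMeasurable hφ.1
    hk hq (r := r) (by linarith) (by rw [hk']; ring)
  rw [eLpNorm_heatKernel N ht (by linarith)] at h1
  have hfin : eLpNorm (heatKernel N 1) (ENNReal.ofReal k) volume ≠ ∞ :=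
    (memLp_heatKernel N one_pos (q := ENNReal.ofReal k) (by simp; linarith)).2.ne
  refine (ENNReal.toReal_mono (ENNReal.mul_ne_top (ENNReal.mul_ne_top ENNReal.ofReal_ne_top
    hfin) hφ.2.ne) h1).trans (le_of_eq ?_)
  rw [ENNReal.toReal_mul, ENNReal.toReal_mul, ENNReal.toReal_ofReal (by positivity), hk',
    mul_comm (t ^ _)]
  congr 3
  ring

open Filter Topology in
theorem continuousOn_heatFlowLp {q r : ℝ} (hq : 1 ≤ q) (hqr : q ≤ r)
    [Fact (1 ≤ ENNReal.ofReal r)]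
    {φ : EuclideanSpace ℝ (Fin N) → ℝ} (hφ : MemLp φ (ENNReal.ofReal q) volume) :
    ContinuousOn (fun t => heatFlowLp (ENNReal.ofReal r) t φ) (Ioi 0) := by
  obtain ⟨k, hk, hk'⟩ := exists_young_exponent hq hqr
  intro t ht
  refine ContinuousAt.continuousWithinAt ?_
  have ht' : 0 < t := ht
  rw [ContinuousAt, tendsto_iff_edist_tendsto_0]
  have hlim := ENNReal.Tendsto.mul_const (b := eLpNorm φ (ENNReal.ofReal q) volume)
    (tendsto_eLpNorm_heatKernel_sub N ht' (q := k) (by linarith)) (Or.inr hφ.2.ne)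
  rw [zero_mul] at hlim
  refine tendsto_of_tendsto_of_tendsto_of_le_of_le' tendsto_const_nhds hlim
    (Eventually.of_forall fun _ => zero_le) ?_
  filter_upwards [lt_mem_nhds ht'] with s hs
  have hms := heatFlowMemLp_of_memLp hq hqr hs hφ
  have hmt := heatFlowMemLp_of_memLp hq hqr ht' hφ
  -- The difference of the flows is a convolution with `G_s - G_t`, so Young's inequality transfers
  -- continuity of the kernel in `L^k` to the flow.
  have hsub : heatFlow s φ - heatFlow t φ = convolution (heatKernel N s - heatKernel N t) φ
      (ContinuousLinearMap.lsmul ℝ ℝ) volume := by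
    ext x
    simp only [heatFlow, convolution_lsmul, Pi.sub_apply, sub_smul]
    exact (integral_sub (hms.1 x) (hmt.1 x)).symm
  rw [heatFlowLp_of_mem hms, heatFlowLp_of_mem hmt, Lp.edist_toLp_toLp, hsub]
  exact eLpNorm_convolution_le
    ((continuous_heatKernel N s).sub (continuous_heatKernel N t)).aestronglyMeasurable hφ.1
    hk hq (by linarith) (by rw [hk']; ring)

end HeatFlow

/-! ### Volterra integrals with singularities at both endpoints. -/

section Volterra

open Filter Topology

theorem intervalIntegrable_one_sub_rpow_mul_rpow {a b : ℝ} (ha : a < 1) (hb : b < 1) :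
    IntervalIntegrable (fun θ : ℝ => (1 - θ) ^ (-a) * θ ^ (-b)) volume 0 1 := by
  have h := (Complex.betaIntegral_convergent (u := ((1 - b : ℝ) : ℂ)) (v := ((1 - a : ℝ) : ℂ))
    (by simpa using hb) (by simpa using ha)).norm
  rw [intervalIntegrable_iff_integrableOn_Ioo_of_le zero_le_one] at h ⊢
  refine h.congr_fun (fun θ hθ => ?_) measurableSet_Ioo
  have h1 : 0 < 1 - θ := by linarith [hθ.2]
  have h2 : (1 : ℂ) - θ = ((1 - θ : ℝ) : ℂ) := by push_cast; rfl
  simp only [norm_mul]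
  rw [Complex.norm_cpow_eq_rpow_re_of_pos hθ.1, h2, Complex.norm_cpow_eq_rpow_re_of_pos h1,
    mul_comm]
  simp

/-- The Euler beta integral `∫₀¹ (1 - θ)^{-a} θ^{-b} dθ`. -/
noncomputable def eulerBeta (a b : ℝ) : ℝ := ∫ θ in (0 : ℝ)..1, (1 - θ) ^ (-a) * θ ^ (-b)

theorem eulerBeta_nonneg (a b : ℝ) : 0 ≤ eulerBeta a b :=
  intervalIntegral.integral_nonneg zero_le_one fun θ hθ =>
    mul_nonneg (Real.rpow_nonneg (by linarith [hθ.2]) _) (Real.rpow_nonneg hθ.1 _)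

variable {E : Type*} [NormedAddCommGroup E] {g : ℝ → ℝ → E} {a b C : ℝ}

/-- The substitution `τ = tθ` moves the integral to the fixed interval `(0,1)` and separates the
power of `t` from an integrable beta weight. Size, integrability and continuity in `t` all follow
from this bound. -/
theorem norm_volterra_rescaled_le (hg : ∀ s τ, 0 < s → 0 < τ → ‖g s τ‖ ≤ C * s ^ (-a) * τ ^ (-b))
    {t θ : ℝ} (ht : 0 < t) (hθ : θ ∈ Ioo (0 : ℝ) 1) :
    ‖g (t - t * θ) (t * θ)‖ ≤ C * t ^ (-a - b) * ((1 - θ) ^ (-a) * θ ^ (-b)) := by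
  have h1 : 0 < 1 - θ := by linarith [hθ.2]
  have h2 : t - t * θ = t * (1 - θ) := by ring
  have h3 := hg (t - t * θ) (t * θ) (by rw [h2]; positivity) (mul_pos ht hθ.1)
  refine h3.trans (le_of_eq ?_)
  rw [h2, Real.mul_rpow ht.le h1.le, Real.mul_rpow ht.le hθ.1.le, sub_eq_add_neg (-a) b,
    Real.rpow_add ht]
  ring

theorem continuousOn_volterra_rescaled
    (hc : ContinuousOn (Function.uncurry g) (Ioi 0 ×ˢ Ioi 0)) {t : ℝ} (ht : 0 < t) :
    ContinuousOn (fun θ => g (t - t * θ) (t * θ)) (Ioo 0 1) := by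
  refine hc.comp (f := fun θ : ℝ => (t - t * θ, t * θ)) (by fun_prop) fun θ hθ => ?_
  refine ⟨?_, mul_pos ht hθ.1⟩
  simp only [mem_Ioi]
  nlinarith [hθ.2]

theorem intervalIntegrable_volterra_rescaled
    (hc : ContinuousOn (Function.uncurry g) (Ioi 0 ×ˢ Ioi 0)) (ha : a < 1) (hb : b < 1)
    (hg : ∀ s τ, 0 < s → 0 < τ → ‖g s τ‖ ≤ C * s ^ (-a) * τ ^ (-b)) {t : ℝ} (ht : 0 < t) :
    IntervalIntegrable (fun θ => g (t - t * θ) (t * θ)) volume 0 1 := by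
  have hB := (intervalIntegrable_one_sub_rpow_mul_rpow ha hb).const_mul (C * t ^ (-a - b))
  rw [intervalIntegrable_iff_integrableOn_Ioo_of_le zero_le_one] at hB ⊢
  refine hB.mono' ((continuousOn_volterra_rescaled hc ht).aestronglyMeasurable measurableSet_Ioo)
    ?_
  exact (ae_restrict_mem measurableSet_Ioo).mono fun θ hθ => norm_volterra_rescaled_le hg ht hθ

theorem intervalIntegrable_volterra
    (hc : ContinuousOn (Function.uncurry g) (Ioi 0 ×ˢ Ioi 0)) (ha : a < 1) (hb : b < 1)
    (hg : ∀ s τ, 0 < s → 0 < τ → ‖g s τ‖ ≤ C * s ^ (-a) * τ ^ (-b)) {t : ℝ} (ht : 0 < t) :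
    IntervalIntegrable (fun τ => g (t - τ) τ) volume 0 t := by
  have h := (intervalIntegrable_volterra_rescaled hc ha hb hg ht).comp_mul_left (c := t⁻¹)
  simpa [ht.ne', mul_inv_cancel_left₀] using h

variable [NormedSpace ℝ E]

theorem volterra_integral_eq_smul (g : ℝ → ℝ → E) (t : ℝ) :
    ∫ τ in (0 : ℝ)..t, g (t - τ) τ = t • ∫ θ in (0 : ℝ)..1, g (t - t * θ) (t * θ) := by
  have := intervalIntegral.smul_integral_comp_mul_left (a := 0) (b := 1)
    (fun τ => g (t - τ) τ) t
  simpa using this.symm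

theorem norm_volterra_le (ha : a < 1) (hb : b < 1)
    (hg : ∀ s τ, 0 < s → 0 < τ → ‖g s τ‖ ≤ C * s ^ (-a) * τ ^ (-b)) {t : ℝ} (ht : 0 < t) :
    ‖∫ τ in (0 : ℝ)..t, g (t - τ) τ‖ ≤ C * eulerBeta a b * t ^ (1 - a - b) := by
  rw [volterra_integral_eq_smul, norm_smul, Real.norm_of_nonneg ht.le]
  have h : ‖∫ θ in (0 : ℝ)..1, g (t - t * θ) (t * θ)‖ ≤ C * t ^ (-a - b) * eulerBeta a b := by
    rw [eulerBeta, ← intervalIntegral.integral_const_mul]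
    refine intervalIntegral.norm_integral_le_of_norm_le zero_le_one ?_
      ((intervalIntegrable_one_sub_rpow_mul_rpow ha hb).const_mul _)
    -- At `θ = 1` the first argument of `g` is `0`, where nothing is assumed; this point is null.
    have h1 : ∀ᵐ θ : ℝ, θ ≠ 1 := by simp [ae_iff]
    filter_upwards [h1] with θ h1 hθ
    exact norm_volterra_rescaled_le hg ht ⟨hθ.1, lt_of_le_of_ne hθ.2 h1⟩
  calc t * ‖∫ θ in (0 : ℝ)..1, g (t - t * θ) (t * θ)‖
      ≤ t * (C * t ^ (-a - b) * eulerBeta a b) := by gcongr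
    _ = C * eulerBeta a b * t ^ (1 - a - b) := by
      rw [show 1 - a - b = 1 + (-a - b) by ring, Real.rpow_add ht, Real.rpow_one]
      ring

theorem continuousOn_volterra (hc : ContinuousOn (Function.uncurry g) (Ioi 0 ×ˢ Ioi 0))
    (ha : a < 1) (hb : b < 1) (hC : 0 ≤ C)
    (hg : ∀ s τ, 0 < s → 0 < τ → ‖g s τ‖ ≤ C * s ^ (-a) * τ ^ (-b)) :
    ContinuousOn (fun t => ∫ τ in (0 : ℝ)..t, g (t - τ) τ) (Ioi 0) := by
  simp_rw [volterra_integral_eq_smul g]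
  refine continuousOn_id.smul ?_
  intro t ht
  have ht' : 0 < t := ht
  refine ContinuousAt.continuousWithinAt ?_
  refine intervalIntegral.continuousAt_of_dominated_interval
    (bound := fun θ => C * (t ^ (-a - b) + 1) * ((1 - θ) ^ (-a) * θ ^ (-b))) ?_ ?_
    ((intervalIntegrable_one_sub_rpow_mul_rpow ha hb).const_mul _) ?_
  · filter_upwards [lt_mem_nhds ht'] with s hs
    exact (intervalIntegrable_volterra_rescaled hc ha hb hg hs).def'.aestronglyMeasurable
  · have h1 : ∀ᵐ θ : ℝ, θ ≠ 1 := by simp [ae_iff]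
    have hlt : ∀ᶠ s in 𝓝 t, s ^ (-a - b) < t ^ (-a - b) + 1 :=
      (Real.continuousAt_rpow_const t _ (Or.inl ht'.ne')).eventually_lt_const (by linarith)
    filter_upwards [lt_mem_nhds ht', hlt] with s hs hs'
    filter_upwards [h1] with θ h1 hθ
    rw [uIoc_of_le zero_le_one] at hθ
    have hθ' : θ ∈ Ioo (0 : ℝ) 1 := ⟨hθ.1, lt_of_le_of_ne hθ.2 h1⟩
    have h2 : 0 ≤ (1 - θ) ^ (-a) * θ ^ (-b) :=
      mul_nonneg (Real.rpow_nonneg (by linarith [hθ.2]) _) (Real.rpow_nonneg hθ.1.le _)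
    exact (norm_volterra_rescaled_le hg hs hθ').trans (by gcongr)
  · have h1 : ∀ᵐ θ : ℝ, θ ≠ 1 := by simp [ae_iff]
    filter_upwards [h1] with θ h1 hθ
    rw [uIoc_of_le zero_le_one] at hθ
    have hθ1 : θ < 1 := lt_of_le_of_ne hθ.2 h1
    have hmem : (t - t * θ, t * θ) ∈ (Ioi 0 ×ˢ Ioi 0 : Set (ℝ × ℝ)) :=
      ⟨by simp only [mem_Ioi]; nlinarith, mul_pos ht' hθ.1⟩
    have hat := hc.continuousAt ((isOpen_Ioi.prod isOpen_Ioi).mem_nhds hmem)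
    exact ContinuousAt.comp (f := fun s : ℝ => (s - s * θ, s * θ)) hat (by fun_prop)

end Volterra

/-! ### Contraction in the weighted space. -/

section FixedPoint

open Filter Topology

variable {E : Type*} [NormedAddCommGroup E] {K : ℝ → E → E} {μ β p C : ℝ}

theorem continuousOn_uncurry_of_locally_lipschitz (hp : 1 < p)
    (hcont : ∀ v, ContinuousOn (fun s => K s v) (Ioi 0))
    (hK : ∀ s, 0 < s → ∀ v w, ‖K s v - K s w‖ ≤
      C * s ^ (-β) * ((‖v‖ ^ (p - 1) + ‖w‖ ^ (p - 1)) * ‖v - w‖)) :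
    ContinuousOn (Function.uncurry K) (Ioi 0 ×ˢ univ) := by
  rintro ⟨s, v⟩ ⟨hs, -⟩
  have hs' : 0 < s := hs
  refine ContinuousAt.continuousWithinAt ?_
  rw [ContinuousAt, tendsto_iff_norm_sub_tendsto_zero]
  have h1 : Tendsto (fun x : ℝ × E => C * x.1 ^ (-β) *
      ((‖x.2‖ ^ (p - 1) + ‖v‖ ^ (p - 1)) * ‖x.2 - v‖) + ‖K x.1 v - K s v‖) (𝓝 (s, v))
      (𝓝 (C * s ^ (-β) * ((‖v‖ ^ (p - 1) + ‖v‖ ^ (p - 1)) * ‖v - v‖) + ‖K s v - K s v‖)) := by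
    have hf : Tendsto (fun x : ℝ × E => x.1) (𝓝 (s, v)) (𝓝 s) := continuous_fst.tendsto _
    have hsn : Tendsto (fun x : ℝ × E => x.2) (𝓝 (s, v)) (𝓝 v) := continuous_snd.tendsto _
    have hKs : Tendsto (fun x : ℝ × E => K x.1 v) (𝓝 (s, v)) (𝓝 (K s v)) :=
      (((hcont v).continuousAt (Ioi_mem_nhds hs')).tendsto).comp hf
    refine Tendsto.add (((hf.rpow_const (Or.inl hs'.ne')).const_mul C).mul
      (((hsn.norm.rpow_const (Or.inr (by linarith))).add_const _).mul ?_)) ?_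
    · exact (hsn.sub_const v).norm
    · exact (hKs.sub_const _).norm
  simp only [sub_self, norm_zero, mul_zero, add_zero] at h1
  have hpos : ∀ᶠ x : ℝ × E in 𝓝 (s, v), 0 < x.1 :=
    (continuous_fst.tendsto (s, v)).eventually (lt_mem_nhds hs')
  refine squeeze_zero' (Eventually.of_forall fun _ => norm_nonneg _) ?_ h1
  filter_upwards [hpos] with x hx
  calc ‖K x.1 x.2 - K s v‖ ≤ ‖K x.1 x.2 - K x.1 v‖ + ‖K x.1 v - K s v‖ :=
        norm_sub_le_norm_sub_add_norm_sub _ _ _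
    _ ≤ _ := by gcongr; exact hK _ hx _ _

/-- The `p - 1` powers of the sizes and the one power of the difference contribute `τ^{-μ}` each,
which makes `τ^{-μp}`. -/
theorem norm_sub_le_of_weighted_bounds (hp : 1 < p) (hC : 0 ≤ C)
    (hK : ∀ s, 0 < s → ∀ v w, ‖K s v - K s w‖ ≤
      C * s ^ (-β) * ((‖v‖ ^ (p - 1) + ‖w‖ ^ (p - 1)) * ‖v - w‖))
    {R D s τ : ℝ} (hR : 0 ≤ R) (hs : 0 < s) (hτ : 0 < τ) {v w : E}
    (hv : ‖v‖ ≤ R * τ ^ (-μ)) (hw : ‖w‖ ≤ R * τ ^ (-μ)) (hvw : ‖v - w‖ ≤ D * τ ^ (-μ)) :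
    ‖K s v - K s w‖ ≤ (2 * C * R ^ (p - 1) * D) * s ^ (-β) * τ ^ (-(μ * p)) := by
  have hp' : 0 ≤ p - 1 := by linarith
  have hpow : ∀ x : E, ‖x‖ ≤ R * τ ^ (-μ) → ‖x‖ ^ (p - 1) ≤ R ^ (p - 1) * τ ^ (-μ * (p - 1)) := by
    intro x hx
    refine (Real.rpow_le_rpow (norm_nonneg _) hx hp').trans (le_of_eq ?_)
    rw [Real.mul_rpow hR (by positivity), ← Real.rpow_mul hτ.le]
  calc ‖K s v - K s w‖ ≤ C * s ^ (-β) * ((‖v‖ ^ (p - 1) + ‖w‖ ^ (p - 1)) * ‖v - w‖) :=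
        hK s hs v w
    _ ≤ C * s ^ (-β) * ((R ^ (p - 1) * τ ^ (-μ * (p - 1)) + R ^ (p - 1) * τ ^ (-μ * (p - 1)))
        * (D * τ ^ (-μ))) := by
        gcongr
        · exact hpow v hv
        · exact hpow w hw
    _ = _ := by
        rw [show -(μ * p) = -μ * (p - 1) + -μ by ring, Real.rpow_add hτ]
        ring

variable [NormedSpace ℝ E] [CompleteSpace E]

/-- Global solvability, for small data, of `u(t) = S(t) + ∫₀ᵗ K(t - τ)(u(τ)) dτ` in the scale-invariant
space of functions with `‖u(t)‖ = O(t^{-μ})`. -/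
theorem exists_global_solution_of_small (hp : 1 < p) (hC : 0 ≤ C) (hβ : β < 1) (hμp : μ * p < 1)
    (hscale : 1 - β - μ * p = -μ)
    (hcont : ∀ v, ContinuousOn (fun s => K s v) (Ioi 0)) (hK0 : ∀ s, 0 < s → K s 0 = 0)
    (hK : ∀ s, 0 < s → ∀ v w, ‖K s v - K s w‖ ≤
      C * s ^ (-β) * ((‖v‖ ^ (p - 1) + ‖w‖ ^ (p - 1)) * ‖v - w‖)) :
    ∃ δ : ℝ, 0 < δ ∧ ∀ S : ℝ → E, ContinuousOn S (Ioi 0) →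
      (∀ t, 0 < t → ‖S t‖ ≤ δ * t ^ (-μ)) →
      ∃ u : ℝ → E, ContinuousOn u (Ioi 0) ∧ (∃ M, ∀ t, 0 < t → t ^ μ * ‖u t‖ ≤ M) ∧
        ∀ t, 0 < t → IntervalIntegrable (fun τ => K (t - τ) (u τ)) volume 0 t ∧
          u t = S t + ∫ τ in (0 : ℝ)..t, K (t - τ) (u τ) := by
  classical
  set B := eulerBeta β (μ * p) with hB
  have hB0 : 0 ≤ B := eulerBeta_nonneg _ _
  obtain ⟨R, hR, hRB⟩ : ∃ R : ℝ, 0 < R ∧ 2 * C * R ^ (p - 1) * B ≤ 1 / 2 := by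
    -- `R` solves `R^{p-1} = 1/(4(CB+1))`; the `+ 1` covers `CB = 0`.
    refine ⟨(1 / (4 * (C * B + 1))) ^ (1 / (p - 1)), by positivity, ?_⟩
    rw [← Real.rpow_mul (by positivity), one_div_mul_cancel (by linarith), Real.rpow_one]
    have : 0 ≤ C * B := by positivity
    rw [show 2 * C * (1 / (4 * (C * B + 1))) * B = (C * B) / (2 * (C * B + 1)) by
      field_simp; ring, div_le_div_iff₀ (by positivity) (by norm_num)]
    linarith
  have hKc := continuousOn_uncurry_of_locally_lipschitz hp hcont hK
  have hKu : ∀ u : ℝ → E, ContinuousOn u (Ioi 0) →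
      ContinuousOn (Function.uncurry fun s τ => K s (u τ)) (Ioi 0 ×ˢ Ioi 0) := by
    intro u hu
    refine hKc.comp (f := fun x : ℝ × ℝ => (x.1, u x.2)) ?_ fun x hx => ⟨hx.1, mem_univ _⟩
    exact continuousOn_fst.prodMk (hu.comp continuousOn_snd fun x hx => hx.2)
  have hbound : ∀ (u : ℝ → E) (Q : ℝ), 0 ≤ Q → (∀ τ, 0 < τ → ‖u τ‖ ≤ Q * τ ^ (-μ)) →
      ∀ s τ, 0 < s → 0 < τ → ‖K s (u τ)‖ ≤
        (2 * C * Q ^ (p - 1) * Q) * s ^ (-β) * τ ^ (-(μ * p)) := by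
    intro u Q hQ hu s τ hs hτ
    have := norm_sub_le_of_weighted_bounds (μ := μ) (w := 0) (D := Q) hp hC hK hQ hs hτ (hu τ hτ)
      (by rw [norm_zero]; positivity) (by simpa using hu τ hτ)
    rwa [hK0 s hs, sub_zero] at this
  -- Half of the radius is left to `S`, the other half to the integral term.
  refine ⟨R / 2, by positivity, fun S hS hSb => ?_⟩
  -- The unknown is `v(t) = t^μ u(t)`, bounded and continuous on `(0,∞)`, so that the sup norm
  -- supplies completeness; `U` undoes the weight. Its value for `τ ≤ 0` plays no role.
  let U : BoundedContinuousFunction (Ioi (0 : ℝ)) E → ℝ → E := fun v τ =>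
    if h : 0 < τ then τ ^ (-μ) • v ⟨τ, h⟩ else 0
  have hUpos : ∀ v τ (h : 0 < τ), U v τ = τ ^ (-μ) • v ⟨τ, h⟩ := fun v τ h => dif_pos h
  have hUc : ∀ v, ContinuousOn (U v) (Ioi 0) := by
    intro v
    rw [continuousOn_iff_continuous_domRestrict]
    have : (Ioi (0 : ℝ)).domRestrict (U v) = fun τ : Ioi (0 : ℝ) => (τ : ℝ) ^ (-μ) • v τ :=
      funext fun τ => hUpos v τ τ.2
    rw [this]
    refine Continuous.smul ?_ v.continuous
    exact continuous_subtype_val.rpow_const fun τ => Or.inl (ne_of_gt τ.2)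
  have hUn : ∀ v τ, 0 < τ → ‖U v τ‖ ≤ ‖v‖ * τ ^ (-μ) := by
    intro v τ hτ
    rw [hUpos v τ hτ, norm_smul, Real.norm_of_nonneg (by positivity), mul_comm]
    gcongr
    exact v.norm_coe_le_norm _
  have hUsub : ∀ v w τ, 0 < τ → ‖U v τ - U w τ‖ ≤ ‖v - w‖ * τ ^ (-μ) := by
    intro v w τ hτ
    rw [hUpos v τ hτ, hUpos w τ hτ, ← smul_sub, norm_smul, Real.norm_of_nonneg (by positivity),
      mul_comm]
    gcongr
    exact (v - w).norm_coe_le_norm _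
  let Φ : (ℝ → E) → ℝ → E := fun u t => S t + ∫ τ in (0 : ℝ)..t, K (t - τ) (u τ)
  have hΦc : ∀ v, ContinuousOn (Φ (U v)) (Ioi 0) := fun v =>
    hS.add (continuousOn_volterra (hKu _ (hUc v)) hβ hμp (by positivity)
      (hbound (U v) ‖v‖ (norm_nonneg _) (hUn v)))
  have hcancel : ∀ t : ℝ, 0 < t → t ^ μ * t ^ (-μ) = 1 := fun t ht => by
    rw [← Real.rpow_add ht]; simp
  have hΦn : ∀ v t, 0 < t →
      t ^ μ * ‖Φ (U v) t‖ ≤ R / 2 + 2 * C * ‖v‖ ^ (p - 1) * ‖v‖ * B := by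
    intro v t ht
    have h1 := norm_volterra_le hβ hμp
      (hbound (U v) ‖v‖ (norm_nonneg _) (hUn v)) ht
    rw [hscale] at h1
    calc t ^ μ * ‖Φ (U v) t‖
        ≤ t ^ μ * (R / 2 * t ^ (-μ) + 2 * C * ‖v‖ ^ (p - 1) * ‖v‖ * B * t ^ (-μ)) := by
          gcongr
          exact (norm_add_le _ _).trans (add_le_add (hSb t ht) h1)
      _ = (R / 2 + 2 * C * ‖v‖ ^ (p - 1) * ‖v‖ * B) * (t ^ μ * t ^ (-μ)) := by ring
      _ = _ := by rw [hcancel t ht, mul_one]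
  let T : BoundedContinuousFunction (Ioi (0 : ℝ)) E → BoundedContinuousFunction (Ioi (0 : ℝ)) E :=
    fun v => BoundedContinuousFunction.ofNormedAddCommGroup
      (fun t : Ioi (0 : ℝ) => (t : ℝ) ^ μ • Φ (U v) t)
      (Continuous.smul (continuous_subtype_val.rpow_const fun τ => Or.inl (ne_of_gt τ.2))
        (continuousOn_iff_continuous_domRestrict.1 (hΦc v)))
      (R / 2 + 2 * C * ‖v‖ ^ (p - 1) * ‖v‖ * B) (fun t => by
        rw [norm_smul, Real.norm_of_nonneg (Real.rpow_nonneg (le_of_lt t.2) _)]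
        exact hΦn v t t.2)
  have hTapp : ∀ v (t : Ioi (0 : ℝ)), T v t = (t : ℝ) ^ μ • Φ (U v) t := fun v t => rfl
  have hmaps : MapsTo T (Metric.closedBall 0 R) (Metric.closedBall 0 R) := by
    intro v hv
    rw [mem_closedBall_zero_iff] at hv ⊢
    refine (BoundedContinuousFunction.norm_le hR.le).2 fun t => ?_
    rw [hTapp, norm_smul, Real.norm_of_nonneg (Real.rpow_nonneg (le_of_lt t.2) _)]
    refine (hΦn v t t.2).trans ?_
    have h1 : ‖v‖ ^ (p - 1) ≤ R ^ (p - 1) :=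
      Real.rpow_le_rpow (norm_nonneg _) hv (by linarith)
    calc R / 2 + 2 * C * ‖v‖ ^ (p - 1) * ‖v‖ * B ≤ R / 2 + 2 * C * R ^ (p - 1) * R * B := by
          gcongr
      _ = R / 2 + (2 * C * R ^ (p - 1) * B) * R := by ring
      _ ≤ R / 2 + 1 / 2 * R := by gcongr
      _ = R := by ring
  have hlip : ∀ v ∈ Metric.closedBall (0 : BoundedContinuousFunction (Ioi (0 : ℝ)) E) R,
      ∀ w ∈ Metric.closedBall (0 : BoundedContinuousFunction (Ioi (0 : ℝ)) E) R,
      ‖T v - T w‖ ≤ 1 / 2 * ‖v - w‖ := by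
    intro v hv w hw
    rw [mem_closedBall_zero_iff] at hv hw
    refine (BoundedContinuousFunction.norm_le (by positivity)).2 fun t => ?_
    have ht : 0 < (t : ℝ) := t.2
    rw [BoundedContinuousFunction.coe_sub, Pi.sub_apply, hTapp, hTapp, ← smul_sub, norm_smul,
      Real.norm_of_nonneg (by positivity)]
    have h1 : Φ (U v) t - Φ (U w) t =
        ∫ τ in (0 : ℝ)..t, (K (t - τ) (U v τ) - K (t - τ) (U w τ)) := by
      rw [intervalIntegral.integral_sub
        (intervalIntegrable_volterra (hKu _ (hUc v)) hβ hμp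
          (hbound (U v) ‖v‖ (norm_nonneg _) (hUn v)) ht)
        (intervalIntegrable_volterra (hKu _ (hUc w)) hβ hμp
          (hbound (U w) ‖w‖ (norm_nonneg _) (hUn w)) ht)]
      simp only [Φ]
      abel
    have h2 := norm_volterra_le (g := fun s τ => K s (U v τ) - K s (U w τ))
      (C := 2 * C * R ^ (p - 1) * ‖v - w‖) hβ hμp
      (fun s τ hs hτ => norm_sub_le_of_weighted_bounds hp hC hK hR.le hs hτ
        ((hUn v τ hτ).trans (by gcongr)) ((hUn w τ hτ).trans (by gcongr)) (hUsub v w τ hτ)) ht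
    rw [hscale] at h2
    rw [h1]
    calc (t : ℝ) ^ μ * ‖∫ τ in (0 : ℝ)..t, (K (t - τ) (U v τ) - K (t - τ) (U w τ))‖
        ≤ (t : ℝ) ^ μ * (2 * C * R ^ (p - 1) * ‖v - w‖ * B * (t : ℝ) ^ (-μ)) := by gcongr
      _ = (2 * C * R ^ (p - 1) * B) * ‖v - w‖ * ((t : ℝ) ^ μ * (t : ℝ) ^ (-μ)) := by ring
      _ ≤ 1 / 2 * ‖v - w‖ := by rw [hcancel t ht, mul_one]; gcongr
  have hcontr : ContractingWith (1 / 2) (hmaps.restrict T _ _) := by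
    refine ⟨by norm_num, LipschitzWith.of_dist_le_mul fun v w => ?_⟩
    have := hlip v v.2 w w.2
    rw [← dist_eq_norm, ← dist_eq_norm] at this
    simpa [Subtype.dist_eq] using this
  obtain ⟨v, hv, hfix, -⟩ := hcontr.exists_fixedPoint' Metric.isClosed_closedBall.isComplete
    hmaps (x := 0) (by simp [hR.le]) (edist_ne_top _ _)
  refine ⟨U v, hUc v, ⟨‖v‖, fun t ht => ?_⟩, fun t ht => ⟨?_, ?_⟩⟩
  · calc t ^ μ * ‖U v t‖ ≤ t ^ μ * (‖v‖ * t ^ (-μ)) := by gcongr; exact hUn v t ht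
      _ = ‖v‖ * (t ^ μ * t ^ (-μ)) := by ring
      _ = ‖v‖ := by rw [hcancel t ht, mul_one]
  · exact intervalIntegrable_volterra (hKu _ (hUc v)) hβ hμp
      (hbound (U v) ‖v‖ (norm_nonneg _) (hUn v)) ht
  · have h1 : T v ⟨t, ht⟩ = v ⟨t, ht⟩ := by rw [hfix]
    rw [hUpos v t ht, ← h1, hTapp, smul_smul, mul_comm, hcancel t ht, one_smul]

end FixedPoint

/-! ### The singular weight `|x|^α`. -/

section Weight

variable {N : ℕ} {α : ℝ}

theorem memLp_indicator_ball_norm_rpow (hN : 1 ≤ N) {b : ℝ} (hb : 0 < b)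
    (hαb : -(N : ℝ) < α * b) :
    MemLp ((Metric.ball (0 : EuclideanSpace ℝ (Fin N)) 1).indicator fun x => ‖x‖ ^ α)
      (ENNReal.ofReal b) volume := by
  have hm : Measurable fun x : EuclideanSpace ℝ (Fin N) => ‖x‖ ^ α := measurable_norm.pow_const α
  rw [memLp_indicator_iff_restrict measurableSet_ball,
    ← integrable_norm_rpow_iff hm.aestronglyMeasurable (by simpa using hb) (by simp),
    ENNReal.toReal_ofReal hb.le]
  refine integrableOn_ball_of_norm_le_rpow (C := 1) (α := -(α * b)) ?_ ?_ (ae_of_all _ fun x => ?_)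
    (hm.norm.pow_const b).aestronglyMeasurable
  · simpa using hN
  · simp; linarith
  · rw [one_mul, neg_neg, Real.norm_of_nonneg (by positivity),
      Real.norm_of_nonneg (by positivity), Real.rpow_mul (norm_nonneg _)]

theorem eLpNorm_indicator_ball_norm_rpow {b R : ℝ} (hb : 0 < b) (hR : 0 < R) :
    eLpNorm ((Metric.ball (0 : EuclideanSpace ℝ (Fin N)) R).indicator fun x => ‖x‖ ^ α)
      (ENNReal.ofReal b) volume = ENNReal.ofReal (R ^ (α + N / b)) *
    eLpNorm ((Metric.ball (0 : EuclideanSpace ℝ (Fin N)) 1).indicator fun x => ‖x‖ ^ α)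
      (ENNReal.ofReal b) volume := by
  have h : ((Metric.ball (0 : EuclideanSpace ℝ (Fin N)) R).indicator fun x => ‖x‖ ^ α) =
      R ^ α • fun x => ((Metric.ball (0 : EuclideanSpace ℝ (Fin N)) 1).indicator
        fun x => ‖x‖ ^ α) (R⁻¹ • x) := by
    ext x
    have hmem : R⁻¹ • x ∈ Metric.ball (0 : EuclideanSpace ℝ (Fin N)) 1 ↔
        x ∈ Metric.ball (0 : EuclideanSpace ℝ (Fin N)) R := by
      rw [mem_ball_zero_iff, mem_ball_zero_iff, norm_smul, Real.norm_of_nonneg (by positivity),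
        inv_mul_lt_iff₀ hR, mul_one]
    by_cases hx : x ∈ Metric.ball (0 : EuclideanSpace ℝ (Fin N)) R
    · rw [Pi.smul_apply, indicator_of_mem hx, indicator_of_mem (hmem.2 hx), norm_smul,
        Real.norm_of_nonneg (by positivity), Real.mul_rpow (by positivity) (norm_nonneg _),
        Real.inv_rpow hR.le, smul_eq_mul, mul_inv_cancel_left₀ (by positivity)]
    · rw [Pi.smul_apply, indicator_of_notMem hx, indicator_of_notMem (fun h => hx (hmem.1 h)),
        smul_zero]
  rw [h, eLpNorm_const_smul, eLpNorm_comp_smul volume _ (inv_pos.2 hR) hb, ← mul_assoc,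
    Real.enorm_of_nonneg (by positivity), ← ENNReal.ofReal_mul (by positivity),
    Real.inv_rpow hR.le, ← Real.rpow_neg hR.le, ← Real.rpow_add hR]
  congr 3
  rw [finrank_euclideanSpace_fin]
  ring

theorem rpow_norm_mul_eq_add (R : ℝ) (f : EuclideanSpace ℝ (Fin N) → ℝ) :
    (fun x => ‖x‖ ^ α * f x) =
      ((Metric.ball (0 : EuclideanSpace ℝ (Fin N)) R).indicator fun x => ‖x‖ ^ α) * f +
        ((Metric.ball (0 : EuclideanSpace ℝ (Fin N)) R)ᶜ.indicator fun x => ‖x‖ ^ α) * f := by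
  rw [← add_mul, indicator_self_add_compl]
  rfl

theorem norm_indicator_compl_ball_le (hα : α ≤ 0) {R : ℝ} (hR : 0 < R)
    (x : EuclideanSpace ℝ (Fin N)) :
    ‖(Metric.ball (0 : EuclideanSpace ℝ (Fin N)) R)ᶜ.indicator (fun x => ‖x‖ ^ α) x‖ ≤ R ^ α := by
  by_cases hx : x ∈ (Metric.ball (0 : EuclideanSpace ℝ (Fin N)) R)ᶜ
  · rw [indicator_of_mem hx, Real.norm_of_nonneg (by positivity)]
    exact Real.rpow_le_rpow_of_nonpos hR (by simpa using hx) hα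
  · rw [indicator_of_notMem hx, norm_zero]
    positivity

theorem outer_weight_mul (hα : α ≤ 0) {R : ℝ} (hR : 0 < R) {q : ℝ≥0∞}
    {f : EuclideanSpace ℝ (Fin N) → ℝ} (hf : MemLp f q volume) :
    MemLp (((Metric.ball (0 : EuclideanSpace ℝ (Fin N)) R)ᶜ.indicator fun x => ‖x‖ ^ α) * f) q
      volume ∧
    eLpNorm (((Metric.ball (0 : EuclideanSpace ℝ (Fin N)) R)ᶜ.indicator fun x => ‖x‖ ^ α) * f) q
      volume ≤ ENNReal.ofReal (R ^ α) * eLpNorm f q volume := by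
  have hle : ∀ x, ‖(((Metric.ball (0 : EuclideanSpace ℝ (Fin N)) R)ᶜ.indicator
      fun x => ‖x‖ ^ α) * f) x‖ ≤ R ^ α * ‖f x‖ := fun x => by
    rw [Pi.mul_apply, norm_mul]
    gcongr
    exact norm_indicator_compl_ball_le hα hR x
  have hm : Measurable ((Metric.ball (0 : EuclideanSpace ℝ (Fin N)) R)ᶜ.indicator
      fun x => ‖x‖ ^ α) :=
    (measurable_norm.pow_const α).indicator measurableSet_ball.compl
  exact ⟨MemLp.of_le_mul hf (hm.aestronglyMeasurable.mul hf.1) (ae_of_all _ hle),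
    eLpNorm_le_mul_eLpNorm_of_ae_le_mul (ae_of_all _ hle) _⟩

theorem inner_weight_mul (hN : 1 ≤ N) {b q R : ℝ} (hb : 0 < b) (hq : 0 < q)
    (hbq : 1 / b + 1 / q = 1) (hαb : -(N : ℝ) < α * b) (hR : 0 < R)
    {f : EuclideanSpace ℝ (Fin N) → ℝ} (hf : MemLp f (ENNReal.ofReal q) volume) :
    MemLp (((Metric.ball (0 : EuclideanSpace ℝ (Fin N)) R).indicator fun x => ‖x‖ ^ α) * f)
      (ENNReal.ofReal 1) volume ∧
    eLpNorm (((Metric.ball (0 : EuclideanSpace ℝ (Fin N)) R).indicator fun x => ‖x‖ ^ α) * f)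
      (ENNReal.ofReal 1) volume ≤ ENNReal.ofReal (R ^ (α + N / b)) *
        eLpNorm ((Metric.ball (0 : EuclideanSpace ℝ (Fin N)) 1).indicator fun x => ‖x‖ ^ α)
          (ENNReal.ofReal b) volume * eLpNorm f (ENNReal.ofReal q) volume := by
  have hm : Measurable ((Metric.ball (0 : EuclideanSpace ℝ (Fin N)) R).indicator
      fun x => ‖x‖ ^ α) :=
    (measurable_norm.pow_const α).indicator measurableSet_ball
  have : ENNReal.HolderTriple (ENNReal.ofReal b) (ENNReal.ofReal q) (ENNReal.ofReal 1) := by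
    constructor
    rw [← ENNReal.ofReal_inv_of_pos hb, ← ENNReal.ofReal_inv_of_pos hq,
      ← ENNReal.ofReal_add (by positivity) (by positivity), ENNReal.ofReal_one, inv_one,
      ← ENNReal.ofReal_one]
    congr 1
    simpa using hbq
  have h1 := eLpNorm_smul_le_mul_eLpNorm (p := ENNReal.ofReal b) (q := ENNReal.ofReal q)
    (r := ENNReal.ofReal 1) hf.1 hm.aestronglyMeasurable (μ := volume)
  rw [eLpNorm_indicator_ball_norm_rpow hb hR] at h1
  refine ⟨⟨hm.aestronglyMeasurable.mul hf.1, h1.trans_lt ?_⟩, h1⟩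
  exact ENNReal.mul_lt_top (ENNReal.mul_lt_top ENNReal.ofReal_lt_top
    (memLp_indicator_ball_norm_rpow hN hb hαb).2) hf.2

/-- The condition on `q` says exactly that `|x|^α` is locally in `L^b`, with `b` conjugate to `q`.
-/
theorem exists_conjugate_weight_exponent (hN : 1 ≤ N) {q : ℝ} (hq : 1 < q)
    (hαq : 1 / q < (N + α) / N) :
    ∃ b : ℝ, 0 < b ∧ 1 / b + 1 / q = 1 ∧ -(N : ℝ) < α * b := by
  have hN' : (0 : ℝ) < N := by exact_mod_cast hN
  have hq1 : 1 / q < 1 := by rw [div_lt_one (by linarith)]; exact hq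
  have hpos : 0 < 1 - 1 / q := by linarith
  refine ⟨1 / (1 - 1 / q), by positivity, by rw [one_div_one_div]; ring, ?_⟩
  rw [mul_one_div, lt_div_iff₀ hpos]
  rw [lt_div_iff₀ hN'] at hαq
  linarith

theorem heatFlowMemLp_rpow_norm_mul (hN : 1 ≤ N) (hα : α ≤ 0) {q r t : ℝ} (hq : 1 < q)
    (hqr : q ≤ r) (hαq : 1 / q < (N + α) / N) (ht : 0 < t)
    {f : EuclideanSpace ℝ (Fin N) → ℝ} (hf : MemLp f (ENNReal.ofReal q) volume) :
    HeatFlowMemLp (ENNReal.ofReal r) t (fun x => ‖x‖ ^ α * f x) := by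
  obtain ⟨b, hb, hbq, hαb⟩ := exists_conjugate_weight_exponent hN hq hαq
  rw [rpow_norm_mul_eq_add 1 f]
  exact (heatFlowMemLp_of_memLp le_rfl (by linarith) ht
    (inner_weight_mul hN hb (by linarith) hbq hαb one_pos hf).1).add
    (heatFlowMemLp_of_memLp hq.le hqr ht (outer_weight_mul hα one_pos hf).1)

theorem continuousOn_heatFlowLp_rpow_norm_mul (hN : 1 ≤ N) (hα : α ≤ 0) {q r : ℝ} (hq : 1 < q)
    (hqr : q ≤ r) (hαq : 1 / q < (N + α) / N) [Fact (1 ≤ ENNReal.ofReal r)]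
    {f : EuclideanSpace ℝ (Fin N) → ℝ} (hf : MemLp f (ENNReal.ofReal q) volume) :
    ContinuousOn (fun t => heatFlowLp (ENNReal.ofReal r) t (fun x => ‖x‖ ^ α * f x)) (Ioi 0) := by
  obtain ⟨b, hb, hbq, hαb⟩ := exists_conjugate_weight_exponent hN hq hαq
  have h1 := (inner_weight_mul hN hb (by linarith) hbq hαb one_pos hf).1
  have h2 := (outer_weight_mul hα one_pos hf).1
  refine ((continuousOn_heatFlowLp (r := r) le_rfl (by linarith) h1).add
    (continuousOn_heatFlowLp hq.le hqr h2)).congr fun t ht => ?_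
  rw [rpow_norm_mul_eq_add 1 f]
  exact heatFlowLp_add (heatFlowMemLp_of_memLp le_rfl (by linarith) ht h1)
    (heatFlowMemLp_of_memLp hq.le hqr ht h2)

/-- The smoothing estimate for `e^{tΔ}(|·|^α f)`, `α ≤ 0`. -/
theorem exists_norm_heatFlowLp_rpow_norm_mul_le (hN : 1 ≤ N) (hα : α ≤ 0) {q r : ℝ} (hq : 1 < q)
    (hqr : q ≤ r) (hαq : 1 / q < (N + α) / N) [Fact (1 ≤ ENNReal.ofReal r)] :
    ∃ C : ℝ, 0 ≤ C ∧ ∀ t : ℝ, 0 < t → ∀ f : EuclideanSpace ℝ (Fin N) → ℝ,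
      MemLp f (ENNReal.ofReal q) volume →
        ‖heatFlowLp (ENNReal.ofReal r) t (fun x => ‖x‖ ^ α * f x)‖ ≤
          C * t ^ (-((N : ℝ) / 2 * (1 / q - 1 / r) - α / 2)) *
            (eLpNorm f (ENNReal.ofReal q) volume).toReal := by
  obtain ⟨b, hb, hbq, hαb⟩ := exists_conjugate_weight_exponent hN hq hαq
  obtain ⟨C₁, hC₁, h₁⟩ := exists_norm_heatFlowLp_le N (q := 1) (r := r) le_rfl (by linarith)
  obtain ⟨C₂, hC₂, h₂⟩ := exists_norm_heatFlowLp_le N hq.le hqr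
  set W := eLpNorm ((Metric.ball (0 : EuclideanSpace ℝ (Fin N)) 1).indicator fun x => ‖x‖ ^ α)
    (ENNReal.ofReal b) volume with hW
  have hWtop : W ≠ ∞ := (memLp_indicator_ball_norm_rpow hN hb hαb).2.ne
  refine ⟨C₁ * W.toReal + C₂, by positivity, fun t ht f hf => ?_⟩
  -- At the parabolic radius `√t` the inner part, estimated from `L^1`, and the outer part,
  -- estimated from `L^q`, carry the same power of `t`.
  set R := t ^ (1 / 2 : ℝ) with hR
  have hR0 : 0 < R := by positivity
  obtain ⟨hi, hi'⟩ := inner_weight_mul hN hb (by linarith) hbq hαb hR0 hf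
  obtain ⟨ho, ho'⟩ := outer_weight_mul hα hR0 hf
  rw [rpow_norm_mul_eq_add R f, heatFlowLp_add (heatFlowMemLp_of_memLp le_rfl (by linarith) ht hi)
    (heatFlowMemLp_of_memLp hq.le hqr ht ho)]
  have hi'' := ENNReal.toReal_mono (ENNReal.mul_ne_top (ENNReal.mul_ne_top
    ENNReal.ofReal_ne_top hWtop) hf.2.ne) hi'
  have ho'' := ENNReal.toReal_mono (ENNReal.mul_ne_top ENNReal.ofReal_ne_top hf.2.ne) ho'
  rw [ENNReal.toReal_mul, ENNReal.toReal_mul, ENNReal.toReal_ofReal (by positivity)] at hi''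
  rw [ENNReal.toReal_mul, ENNReal.toReal_ofReal (by positivity)] at ho''
  set F := (eLpNorm f (ENNReal.ofReal q) volume).toReal
  have e1 : t ^ (-((N : ℝ) / 2 * (1 / 1 - 1 / r))) * R ^ (α + N / b) =
      t ^ (-((N : ℝ) / 2 * (1 / q - 1 / r) - α / 2)) := by
    rw [hR, ← Real.rpow_mul ht.le, ← Real.rpow_add ht]
    congr 1
    rw [div_eq_mul_one_div (N : ℝ) b, eq_sub_of_add_eq hbq]
    ring
  have e2 : t ^ (-((N : ℝ) / 2 * (1 / q - 1 / r))) * R ^ α =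
      t ^ (-((N : ℝ) / 2 * (1 / q - 1 / r) - α / 2)) := by
    rw [hR, ← Real.rpow_mul ht.le, ← Real.rpow_add ht]
    congr 1
    ring
  calc _ ≤ C₁ * t ^ (-((N : ℝ) / 2 * (1 / 1 - 1 / r))) * (R ^ (α + N / b) * W.toReal * F) +
        C₂ * t ^ (-((N : ℝ) / 2 * (1 / q - 1 / r))) * (R ^ α * F) := by
        refine (norm_add_le _ _).trans (add_le_add ((h₁ t ht _ hi).trans ?_)
          ((h₂ t ht _ ho).trans ?_))
        · gcongr
        · gcongr
    _ = C₁ * W.toReal * F * (t ^ (-((N : ℝ) / 2 * (1 / 1 - 1 / r))) * R ^ (α + N / b)) +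
        C₂ * F * (t ^ (-((N : ℝ) / 2 * (1 / q - 1 / r))) * R ^ α) := by ring
    _ = _ := by rw [e1, e2]; ring

end Weight

/-! ### The nonlinearity `|v|^p` from `L^r` to `L^{r/p}`. -/

section Power

/-- For `b ≤ a`, Bernoulli's inequality at `b/a` is the tangent-line bound `a^p - b^p ≤ p a^{p-1}(a
- b)`. -/
theorem abs_rpow_sub_rpow_le {p : ℝ} (hp : 1 ≤ p) {a b : ℝ} (ha : 0 ≤ a) (hb : 0 ≤ b) :
    |a ^ p - b ^ p| ≤ p * ((a ^ (p - 1) + b ^ (p - 1)) * |a - b|) := by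
  wlog hab : b ≤ a generalizing a b
  · rw [abs_sub_comm, abs_sub_comm a, add_comm (a ^ (p - 1))]
    exact this hb ha (le_of_not_ge hab)
  rw [abs_of_nonneg (sub_nonneg.2 (Real.rpow_le_rpow hb hab (by linarith))),
    abs_of_nonneg (sub_nonneg.2 hab)]
  rcases ha.eq_or_lt with rfl | ha'
  · have : b = 0 := le_antisymm hab hb
    simp [this]
  have h1 := one_add_mul_self_le_rpow_one_add (s := b / a - 1) (by
    have : 0 ≤ b / a := by positivity
    linarith) hp
  rw [add_sub_cancel, Real.div_rpow hb ha, le_div_iff₀ (by positivity)] at h1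
  have h2 : a ^ p = a ^ (p - 1) * a := by
    rw [← Real.rpow_add_one ha'.ne']; ring_nf
  have h3 : (1 + p * (b / a - 1)) * a ^ p = a ^ p + p * (a ^ (p - 1) * (b - a)) := by
    rw [h2]; field_simp
  have h4 : 0 ≤ p * (b ^ (p - 1) * (a - b)) :=
    mul_nonneg (by linarith) (mul_nonneg (Real.rpow_nonneg hb _) (sub_nonneg.2 hab))
  rw [h3] at h1
  linarith

variable {X : Type*} [MeasurableSpace X] {μ : Measure X}

theorem memLp_abs_rpow {p r : ℝ} (hp : 0 < p) {v : X → ℝ}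
    (hv : MemLp v (ENNReal.ofReal r) μ) :
    MemLp (fun x => |v x| ^ p) (ENNReal.ofReal (r / p)) μ := by
  have := hv.norm_rpow_div (ENNReal.ofReal p)
  rwa [ENNReal.toReal_ofReal hp.le, ← ENNReal.ofReal_div_of_pos hp] at this

theorem eLpNorm_abs_rpow_mul_le {p r : ℝ} (hp : 1 < p) (hr : 0 < r) {v w : X → ℝ}
    (hv : MemLp v (ENNReal.ofReal r) μ) (hw : MemLp w (ENNReal.ofReal r) μ) :
    eLpNorm (fun x => |v x| ^ (p - 1) * w x) (ENNReal.ofReal (r / p)) μ ≤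
      eLpNorm v (ENNReal.ofReal r) μ ^ (p - 1) * eLpNorm w (ENNReal.ofReal r) μ := by
  have hp1 : 0 < p - 1 := by linarith
  have hp0 : 0 < p := by linarith
  have : ENNReal.HolderTriple (ENNReal.ofReal (r / (p - 1))) (ENNReal.ofReal r)
      (ENNReal.ofReal (r / p)) := by
    constructor
    rw [← ENNReal.ofReal_inv_of_pos (by positivity), ← ENNReal.ofReal_inv_of_pos hr,
      ← ENNReal.ofReal_inv_of_pos (by positivity),
      ← ENNReal.ofReal_add (by positivity) (by positivity)]
    congr 1
    field_simp
    ring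
  have h1 := eLpNorm_smul_le_mul_eLpNorm (p := ENNReal.ofReal (r / (p - 1)))
    (q := ENNReal.ofReal r) (r := ENNReal.ofReal (r / p)) hw.1 (memLp_abs_rpow hp1 hv).1
  have h2 := eLpNorm_norm_rpow (μ := μ) (p := ENNReal.ofReal (r / (p - 1))) v hp1
  rw [← ENNReal.ofReal_mul (by positivity), div_mul_cancel₀ _ hp1.ne'] at h2
  simp only [Real.norm_eq_abs] at h2
  rw [h2] at h1
  exact h1

theorem toReal_eLpNorm_abs_rpow_sub_le {p r : ℝ} (hp : 1 < p) (hpr : p ≤ r)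
    (v w : Lp ℝ (ENNReal.ofReal r) μ) :
    (eLpNorm (fun x => |v x| ^ p - |w x| ^ p) (ENNReal.ofReal (r / p)) μ).toReal ≤
      p * ((‖v‖ ^ (p - 1) + ‖w‖ ^ (p - 1)) * ‖v - w‖) := by
  have hp0 : 0 < p := by linarith
  have hr : 0 < r := by linarith
  have hv := Lp.memLp v
  have hw := Lp.memLp w
  have hd : MemLp (fun x => |v x - w x|) (ENNReal.ofReal r) μ := (hv.sub hw).norm
  have hpt : ∀ x, ‖|v x| ^ p - |w x| ^ p‖ ≤
      p * ‖|v x| ^ (p - 1) * |v x - w x| + |w x| ^ (p - 1) * |v x - w x|‖ := by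
    intro x
    rw [Real.norm_eq_abs, Real.norm_of_nonneg (by positivity), ← add_mul]
    refine (abs_rpow_sub_rpow_le hp.le (abs_nonneg _) (abs_nonneg _)).trans ?_
    exact mul_le_mul_of_nonneg_left (mul_le_mul_of_nonneg_left
      (abs_abs_sub_abs_le_abs_sub _ _) (by positivity)) hp0.le
  have h1 := eLpNorm_le_mul_eLpNorm_of_ae_le_mul (ae_of_all μ hpt) (ENNReal.ofReal (r / p))
  have h2 := eLpNorm_add_le ((memLp_abs_rpow (p := p - 1) (by linarith) hv).1.mul hd.1)
    ((memLp_abs_rpow (p := p - 1) (by linarith) hw).1.mul hd.1)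
    (p := ENNReal.ofReal (r / p)) (by
      rw [ENNReal.one_le_ofReal, one_le_div hp0]; exact hpr)
  have hd' : eLpNorm (fun x => |v x - w x|) (ENNReal.ofReal r) μ =
      eLpNorm (v - w : Lp ℝ (ENNReal.ofReal r) μ) (ENNReal.ofReal r) μ := by
    rw [eLpNorm_congr_ae (Lp.coeFn_sub v w)]
    exact eLpNorm_norm (fun x => v x - w x)
  have h3 := h1.trans (mul_le_mul_right (h2.trans (add_le_add
    (eLpNorm_abs_rpow_mul_le hp hr hv hd) (eLpNorm_abs_rpow_mul_le hp hr hw hd))) _)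
  rw [hd', ← add_mul] at h3
  have hfin : ∀ f : Lp ℝ (ENNReal.ofReal r) μ, eLpNorm f (ENNReal.ofReal r) μ ^ (p - 1) ≠ ∞ :=
    fun f => ENNReal.rpow_ne_top_of_nonneg (by linarith) (Lp.memLp f).2.ne
  have h4 := ENNReal.toReal_mono (ENNReal.mul_ne_top ENNReal.ofReal_ne_top
    (ENNReal.mul_ne_top (ENNReal.add_ne_top.2 ⟨hfin v, hfin w⟩) (Lp.memLp (v - w)).2.ne)) h3
  rwa [ENNReal.toReal_mul, ENNReal.toReal_mul, ENNReal.toReal_add (hfin v) (hfin w),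
    ENNReal.toReal_ofReal hp0.le, ← ENNReal.toReal_rpow, ← ENNReal.toReal_rpow, ← Lp.norm_def,
    ← Lp.norm_def, ← Lp.norm_def] at h4

end Power

/-! ### Choice of `r` and assembly of the solution. -/

theorem exists_admissible_exponent {n α σ p : ℝ} (hn : 2 ≤ n) (hα : -2 < α) (hσ : -1 < σ)
    (hσ' : σ < 0) (hp : 1 + (2 + α) / (n - 2 * (σ + 1)) ≤ p) :
    ∃ r : ℝ, 0 < r ∧
      max ((α * p + 2) / (n * p * (p - 1))) (1 / (n * (p - 1) / (2 + α)) + 2 * σ / n) < 1 / r ∧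
      1 / r < min (1 / (n * (p - 1) / (2 + α))) ((n + α) / (n * p)) := by
  have ha : 0 < 2 + α := by linarith
  have hm : 0 < n - 2 * (σ + 1) := by linarith
  have hp1 : 0 < p - 1 := by have := div_pos ha hm; linarith
  have hp0 : 0 < p := by linarith
  have hn0 : 0 < n := by linarith
  have hcrit : 2 + α ≤ (p - 1) * (n - 2 * (σ + 1)) := by
    rw [← div_le_iff₀ hm]; linarith
  rw [one_div_div]
  -- The lower bounds may be negative; the extra `0` ensures that the chosen `1/r` is positive.
  have h1 : max (max ((α * p + 2) / (n * p * (p - 1))) ((2 + α) / (n * (p - 1)) + 2 * σ / n)) 0 <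
      min ((2 + α) / (n * (p - 1))) ((n + α) / (n * p)) := by
    refine max_lt (max_lt (lt_min ?_ ?_) (lt_min ?_ ?_)) (lt_min (by positivity) ?_)
    · rw [div_lt_div_iff₀ (by positivity) (by positivity)]
      nlinarith [mul_pos hn0 hp1]
    · rw [div_lt_div_iff₀ (by positivity) (by positivity)]
      -- This is `2 + α < n(p - 1)`, which `hcrit` gives since `σ + 1 > 0`.
      have : α * p + 2 < (n + α) * (p - 1) := by nlinarith
      calc (α * p + 2) * (n * p) < ((n + α) * (p - 1)) * (n * p) := by gcongr
        _ = _ := by ring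
    · have : 2 * σ / n < 0 := div_neg_of_neg_of_pos (by linarith) hn0
      linarith
    · have e : (2 + α) / (n * (p - 1)) + 2 * σ / n =
          (2 + α + 2 * σ * (p - 1)) / (n * (p - 1)) := by field_simp
      rw [e, div_lt_div_iff₀ (by positivity) (by positivity)]
      -- By `hcrit` the right side is at least `(2+α)p + 2σ(p-1)`, which exceeds the left by
      -- `-2σ(p-1)²` or more.
      have : (2 + α + 2 * σ * (p - 1)) * p < (n + α) * (p - 1) := by
        nlinarith [mul_pos hp1 hp1, mul_pos (mul_pos hp1 hp1) (neg_pos.2 hσ')]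
      calc _ = ((2 + α + 2 * σ * (p - 1)) * p) * n := by ring
        _ < ((n + α) * (p - 1)) * n := by gcongr
        _ = _ := by ring
    · exact div_pos (by linarith) (by positivity)
  obtain ⟨x, hx, hx'⟩ := exists_between h1
  rw [max_lt_iff] at hx
  exact ⟨1 / x, one_div_pos.2 hx.2, by rw [one_div_one_div]; exact hx.1,
    by rw [one_div_one_div]; exact hx'⟩

theorem norm_heatFlowLp_source_sub_le {N : ℕ} {α p r C s : ℝ} (hp : 1 < p) (hpr : p < r)
    [Fact (1 ≤ ENNReal.ofReal r)] (hN : 1 ≤ N) (hα : α ≤ 0) (hs : 0 < s) (hC : 0 ≤ C)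
    (hαq : 1 / (r / p) < (N + α) / N) {β : ℝ}
    (hbound : ∀ f : EuclideanSpace ℝ (Fin N) → ℝ, MemLp f (ENNReal.ofReal (r / p)) volume →
        ‖heatFlowLp (ENNReal.ofReal r) s (fun x => ‖x‖ ^ α * f x)‖ ≤
          C * s ^ (-β) * (eLpNorm f (ENNReal.ofReal (r / p)) volume).toReal)
    (v w : Lp ℝ (ENNReal.ofReal r) (volume : Measure (EuclideanSpace ℝ (Fin N)))) :
    ‖heatFlowLp (ENNReal.ofReal r) s (fun x => ‖x‖ ^ α * |v x| ^ p) -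
      heatFlowLp (ENNReal.ofReal r) s (fun x => ‖x‖ ^ α * |w x| ^ p)‖ ≤
      C * p * s ^ (-β) * ((‖v‖ ^ (p - 1) + ‖w‖ ^ (p - 1)) * ‖v - w‖) := by
  have hp0 : 0 < p := by linarith
  have hq : 1 < r / p := by rwa [one_lt_div hp0]
  have hqr : r / p ≤ r := div_le_self (by linarith) hp.le
  have hv := memLp_abs_rpow hp0 (Lp.memLp v)
  have hw := memLp_abs_rpow hp0 (Lp.memLp w)
  rw [← heatFlowLp_sub (heatFlowMemLp_rpow_norm_mul hN hα hq hqr hαq hs hv)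
    (heatFlowMemLp_rpow_norm_mul hN hα hq hqr hαq hs hw)]
  have h := hbound _ (hv.sub hw)
  have e : ((fun x => ‖x‖ ^ α * |v x| ^ p) - fun x => ‖x‖ ^ α * |w x| ^ p) =
      fun x => ‖x‖ ^ α * ((fun x => |v x| ^ p) - fun x => |w x| ^ p) x := by
    ext x; simp only [Pi.sub_apply]; ring
  rw [e]
  calc _ ≤ _ := h
    _ ≤ C * s ^ (-β) * (p * ((‖v‖ ^ (p - 1) + ‖w‖ ^ (p - 1)) * ‖v - w‖)) := by
        gcongr
        exact toReal_eLpNorm_abs_rpow_sub_le hp hpr.le v w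
    _ = _ := by ring

/-- The representative of `0` vanishes only almost everywhere, but convolution does not see null
sets. -/
theorem heatFlowLp_source_zero {N : ℕ} {α p r : ℝ} (hp : 0 < p) (s : ℝ) :
    heatFlowLp (ENNReal.ofReal r) s (fun x => ‖x‖ ^ α *
      |(0 : Lp ℝ (ENNReal.ofReal r) (volume : Measure (EuclideanSpace ℝ (Fin N)))) x| ^ p) = 0 := by
  have h0 : heatFlow s (fun x => ‖x‖ ^ α *
      |(0 : Lp ℝ (ENNReal.ofReal r) (volume : Measure (EuclideanSpace ℝ (Fin N)))) x| ^ p) = 0 := by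
    have hz := Lp.coeFn_zero ℝ (ENNReal.ofReal r) (volume : Measure (EuclideanSpace ℝ (Fin N)))
    have : (fun x => ‖x‖ ^ α * |(0 : Lp ℝ (ENNReal.ofReal r)
        (volume : Measure (EuclideanSpace ℝ (Fin N)))) x| ^ p) =ᵐ[volume] 0 := by
      filter_upwards [hz] with x hx
      rw [hx]
      simp [Real.zero_rpow hp.ne']
    unfold heatFlow
    rw [convolution_congr _ Filter.EventuallyEq.rfl this, convolution_zero]
  unfold heatFlowLp
  split_ifs with h
  · exact (MemLp.toLp_congr h MemLp.zero (by rw [h0])).trans (MemLp.toLp_zero _)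
  · rfl

theorem theorem1p5 (N : ℕ) (hN : 2 ≤ N) (α σ p pc ℓ : ℝ)
    (hα : -2 < α) (hα' : α < 0) (hσ : -1 < σ) (hσ' : σ < 0)
    (hp : 1 + (2 + α) / (N - 2 * (σ + 1)) ≤ p)
    (hpc : pc = N * (p - 1) / (2 + α))
    (hℓ : ℓ = N * (p - 1) / (2 + α + 2 * (σ + 1) * (p - 1))) :
    ∃ (r : ℝ) (_ : Fact (1 ≤ ENNReal.ofReal r)),
      p < r ∧
      max ((α * p + 2) / (N * p * (p - 1))) (1 / pc + 2 * σ / N) < 1 / r ∧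
      1 / r < min (1 / pc) ((N + α) / (N * p)) ∧
      ∃ ε : ℝ, 0 < ε ∧
        ∀ (u₀ : Lp ℝ (ENNReal.ofReal pc) (volume : Measure (EuclideanSpace ℝ (Fin N))))
          (w : Lp ℝ (ENNReal.ofReal ℓ) (volume : Measure (EuclideanSpace ℝ (Fin N)))),
          ‖u₀‖ + ‖w‖ < ε →
          ∃ u : ℝ → Lp ℝ (ENNReal.ofReal r) (volume : Measure (EuclideanSpace ℝ (Fin N))),
            IsGlobalMildSolution α p (fun t => t ^ σ) u₀ w (ENNReal.ofReal r) u ∧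
            ∃ M : ℝ, ∀ t : ℝ, 0 < t → t ^ ((N : ℝ) / 2 * (1 / pc - 1 / r)) * ‖u t‖ ≤ M := by
  have hn : (2 : ℝ) ≤ N := by exact_mod_cast hN
  have hN1 : 1 ≤ N := by omega
  have ha : 0 < 2 + α := by linarith
  have hm : 0 < N - 2 * (σ + 1) := by linarith
  have hp1 : 0 < p - 1 := by have := div_pos ha hm; linarith
  have hp0 : 0 < p := by linarith
  have hn0 : (0 : ℝ) < N := by linarith
  have hcrit : 2 + α ≤ (p - 1) * (N - 2 * (σ + 1)) := by
    rw [← div_le_iff₀ hm]; linarith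
  obtain ⟨r, hr, hlow, hup⟩ := exists_admissible_exponent hn hα hσ hσ' hp
  rw [← hpc] at hlow hup
  have hpc0 : 0 < pc := by rw [hpc]; positivity
  have hs : 0 < 2 * (σ + 1) * (p - 1) := mul_pos (by linarith) hp1
  have hℓ1 : 1 ≤ ℓ := by
    rw [hℓ, one_le_div (by positivity)]
    nlinarith
  have hℓpc : ℓ ≤ pc := by
    rw [hℓ, hpc]
    exact div_le_div_of_nonneg_left (by positivity) ha (by linarith)
  have hpcr : pc ≤ r := ((one_div_lt_one_div hr hpc0).1 (hup.trans_le (min_le_left _ _))).le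
  have hxw : 1 / r < (N + α) / (N * p) := hup.trans_le (min_le_right _ _)
  have hpr : p < r := by
    rw [div_lt_div_iff₀ hr (by positivity)] at hxw
    nlinarith
  have hfact : Fact (1 ≤ ENNReal.ofReal r) := ⟨by rw [ENNReal.one_le_ofReal]; linarith⟩
  refine ⟨r, hfact, hpr, hlow, hup, ?_⟩
  -- In terms of `X = N/r` and `P = N/p_c`, the exponents `μ`, `β`, `κ` are affine in `X`, and `p_c`
  -- enters only through `P(p-1) = 2 + α`.
  set X := N * (1 / r) with hX
  set P := N * (1 / pc) with hP
  have hPp : P * (p - 1) = 2 + α := by rw [hP, hpc]; field_simp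
  have hLP : N * (1 / ℓ) = P + 2 * (σ + 1) := by
    rw [hP, hpc, hℓ]; field_simp
  have hXP : X < P := mul_lt_mul_of_pos_left (hup.trans_le (min_le_left _ _)) hn0
  have hXσ : P + 2 * σ < X := by
    have := mul_lt_mul_of_pos_left ((le_max_right _ _).trans_lt hlow) hn0
    rwa [mul_add, mul_div_cancel₀ _ hn0.ne'] at this
  have hXα : α * p + 2 < X * (p * (p - 1)) := by
    have := (le_max_left _ _).trans_lt hlow
    rw [div_lt_iff₀ (by positivity)] at this
    calc _ < _ := this
      _ = _ := by rw [hX]; ring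
  set μ := (N : ℝ) / 2 * (1 / pc - 1 / r) with hμ
  have hμ' : μ = (P - X) / 2 := by rw [hμ, hP, hX]; ring
  set β := (N : ℝ) / 2 * (1 / (r / p) - 1 / r) - α / 2 with hβ
  have hβ' : β = ((p - 1) * X - α) / 2 := by rw [hβ, hX, one_div_div]; ring
  set κ := (N : ℝ) / 2 * (1 / ℓ - 1 / r) with hκ
  have hκ' : κ = (P + 2 * (σ + 1) - X) / 2 := by rw [← hLP, hκ, hX]; ring
  have hβ1 : β < 1 := by rw [hβ']; nlinarith
  have hκ1 : κ < 1 := by rw [hκ']; linarith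
  have hμp : μ * p < 1 := by
    have : (P - X) * p * (p - 1) < 2 * (p - 1) := by
      linear_combination hXα + p * hPp
    have := lt_of_mul_lt_mul_right this hp1.le
    rw [hμ']; linarith
  have hscale : 1 - β - μ * p = -μ := by
    rw [hμ', hβ']; linear_combination (-1 / 2) * hPp
  have hscale' : 1 - κ - (-σ) = -μ := by rw [hμ', hκ']; ring
  have hq : 1 < r / p := by rwa [one_lt_div hp0]
  have hqr : r / p ≤ r := div_le_self hr.le (by linarith)
  have hαq : 1 / (r / p) < (N + α) / N := by
    rw [one_div_div, div_lt_div_iff₀ hr hn0]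
    rw [div_lt_div_iff₀ hr (by positivity)] at hxw
    linarith
  obtain ⟨C, hC, hCb⟩ := exists_norm_heatFlowLp_rpow_norm_mul_le hN1 hα'.le hq hqr hαq
  obtain ⟨δ, hδ, hsol⟩ := exists_global_solution_of_small
    (K := fun s (v : Lp ℝ (ENNReal.ofReal r) (volume : Measure (EuclideanSpace ℝ (Fin N)))) =>
      heatFlowLp (ENNReal.ofReal r) s (fun x => ‖x‖ ^ α * |v x| ^ p))
    (μ := μ) (p := p) (C := C * p) (β := β) (by linarith) (by positivity) hβ1 hμp hscale
    (fun v => continuousOn_heatFlowLp_rpow_norm_mul hN1 hα'.le hq hqr hαq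
      (memLp_abs_rpow hp0 (Lp.memLp v)))
    (fun s _ => heatFlowLp_source_zero hp0 s)
    (fun s hs v w => norm_heatFlowLp_source_sub_le (by linarith) hpr hN1 hα'.le hs hC hαq
      (hCb s hs) v w)
  obtain ⟨C₁, hC₁, hC₁b⟩ := exists_norm_heatFlowLp_le N (hℓ1.trans hℓpc) hpcr
  obtain ⟨C₂, hC₂, hC₂b⟩ := exists_norm_heatFlowLp_le N hℓ1 (hℓpc.trans hpcr)
  set B := eulerBeta κ (-σ) with hB
  have hB0 : 0 ≤ B := eulerBeta_nonneg _ _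
  -- Chosen so that the free and forced parts together stay below `δ t^{-μ}`; the `+ 1` keeps the
  -- denominator positive.
  refine ⟨δ / (C₁ + C₂ * B + 1), by positivity, fun u₀ w huw => ?_⟩
  have hu₀ := Lp.memLp u₀
  have hw := Lp.memLp w
  have hu₀n : 0 ≤ ‖u₀‖ := ENNReal.toReal_nonneg
  have hwn : 0 ≤ ‖w‖ := ENNReal.toReal_nonneg
  have hsmall : C₁ * ‖u₀‖ + C₂ * ‖w‖ * B ≤ δ := by
    rw [lt_div_iff₀ (by positivity)] at huw
    have := mul_nonneg hC₁ hwn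
    have := mul_nonneg (mul_nonneg hC₂ hB0) hu₀n
    linarith
  have hwm : ∀ s, 0 < s → HeatFlowMemLp (ENNReal.ofReal r) s w := fun s hs =>
    heatFlowMemLp_of_memLp hℓ1 (hℓpc.trans hpcr) hs hw
  have hforce : ∀ s τ, 0 < s → heatFlowLp (ENNReal.ofReal r) s (fun x => τ ^ σ * w x) =
      τ ^ σ • heatFlowLp (ENNReal.ofReal r) s w := fun s τ hs =>
    heatFlowLp_const_smul (hwm s hs) (τ ^ σ)
  set g : ℝ → ℝ → Lp ℝ (ENNReal.ofReal r) (volume : Measure (EuclideanSpace ℝ (Fin N))) :=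
    fun s τ => heatFlowLp (ENNReal.ofReal r) s (fun x => τ ^ σ * w x) with hg
  have hgc : ContinuousOn (Function.uncurry g) (Ioi 0 ×ˢ Ioi 0) := by
    have h1 : ContinuousOn (fun x : ℝ × ℝ => x.2 ^ σ) (Ioi 0 ×ˢ Ioi 0) :=
      continuousOn_snd.rpow_const fun x hx => Or.inl (ne_of_gt hx.2)
    have h2 : ContinuousOn (fun x : ℝ × ℝ => heatFlowLp (ENNReal.ofReal r) x.1 w)
        (Ioi 0 ×ˢ Ioi 0) :=
      (continuousOn_heatFlowLp hℓ1 (hℓpc.trans hpcr) hw).comp continuousOn_fst fun x hx => hx.1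
    exact (h1.smul h2).congr fun x hx => hforce x.1 x.2 hx.1
  have hgb : ∀ s τ, 0 < s → 0 < τ → ‖g s τ‖ ≤ C₂ * ‖w‖ * s ^ (-κ) * τ ^ (-(-σ)) := by
    intro s τ hs hτ
    have h1 := hC₂b s hs w hw
    rw [← Lp.norm_def] at h1
    simp only [hg]
    rw [hforce s τ hs, norm_smul, Real.norm_of_nonneg (by positivity), neg_neg]
    calc τ ^ σ * _ ≤ τ ^ σ * (C₂ * s ^ (-κ) * ‖w‖) := by gcongr
      _ = _ := by ring
  have hσ1 : -σ < 1 := by linarith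
  -- Both terms that do not involve `u` are put into `S`.
  obtain ⟨u, huc, ⟨M, hM⟩, hu⟩ := hsol
    (fun t => heatFlowLp (ENNReal.ofReal r) t u₀ + ∫ τ in (0 : ℝ)..t, g (t - τ) τ)
    ((continuousOn_heatFlowLp (hℓ1.trans hℓpc) hpcr hu₀).add
      (continuousOn_volterra hgc hκ1 hσ1 (mul_nonneg hC₂ hwn) hgb)) (by
    intro t ht
    have h1 := hC₁b t ht u₀ hu₀
    rw [← Lp.norm_def, ← hμ] at h1
    have h2 := norm_volterra_le hκ1 hσ1 hgb ht
    rw [hscale', ← hB] at h2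
    calc _ ≤ C₁ * t ^ (-μ) * ‖u₀‖ + C₂ * ‖w‖ * B * t ^ (-μ) :=
          (norm_add_le _ _).trans (add_le_add h1 h2)
      _ = (C₁ * ‖u₀‖ + C₂ * ‖w‖ * B) * t ^ (-μ) := by ring
      _ ≤ δ * t ^ (-μ) := by gcongr)
  refine ⟨u, ⟨huc, fun t ht => ?_, fun t τ hτ hτt => ?_, fun t τ hτ hτt => ?_,
    fun t ht => (hu t ht).1, fun t ht => ?_, fun t ht => ?_⟩, M, hM⟩
  · exact heatFlowMemLp_of_memLp (hℓ1.trans hℓpc) hpcr ht hu₀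
  · exact heatFlowMemLp_rpow_norm_mul hN1 hα'.le hq hqr hαq (sub_pos.2 hτt)
      (memLp_abs_rpow hp0 (Lp.memLp (u τ)))
  · exact (hwm (t - τ) (sub_pos.2 hτt)).const_smul (τ ^ σ)
  · exact intervalIntegrable_volterra hgc hκ1 hσ1 hgb ht
  · rw [(hu t ht).2, add_right_comm]
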